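/- Let $n\ge 0$, let $\Omega\subset\mathbb C^{n+1}$ be a domain (open and connected), and let $p\in\partial\Omega$. Suppose that $\partial\Omega$ is smooth near $p$ and $\Omega$ is strictly pseudoconvex at $p$. Let $\rho$ be a smooth real-valued function near $p$ such that, near $p$, $\Omega=\{\rho<0\}$, $\partial\Omega=\{\rho=0\}$, and $\partial\rho=(\rho_{z_1},\dots,\rho_{z_{n+1}})\ne 0$ on $\partial\Omega$. Write $$T_p^{1,0}\partial\Omega=\Big\{(t_1,\dots,t_{n+1})\in\mathbb C^{n+1}:\ \sum_{j=1}^{n+1}\rho_{z_j}(p)\,t_j=0\Big\}.$$ (Strict pseudoconvexity at $p$ means that the Levi form $\sum_{j,k}\rho_{z_j\bar z_k}(p)t_j\bar t_k$ of a smooth defining function is positive definite on this space.) Let $P(z,\partial)=\sum_{|\alpha|\le m}a_\alpha(z)(\partial/\partial z)^\alpha$ be a linear partial differential operator with coefficients holomorphic in an open neighbourhood $V$ of $p$, with principal symbol $P_m(z,\zeta)=\sum_{|\alpha|=m}a_\alpha(z)\zeta^\alpha$, and write $P_{m,j}=\partial P_m/\partial z_j$ and $P_m^{(j)}=\partial P_m/\partial\zeta_j$.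 Assume that $\partial\Omega$ is simply characteristic at $p$ with respect to $P$, that is, $$P_m(p,\partial\rho(p))=0\quad\text{and}\quad \big(P_m^{(1)},\dots,P_m^{(n+1)}\big)(p,\partial\rho(p))\neq(0,\dots,0).$$ Let $Q_p(t,\bar t)=\sum_{0\le j,k\le n+1}q_{j,k}\,t_j\bar t_k$, $t=(t_0,\dots,t_{n+1})\in\mathbb C^{n+2}$, be the Kashiwara–Kawai Hermitian form, whose coefficients are, for $1\le j,k\le n+1$ and with all functions evaluated at $z=p$, $\zeta=\partial\rho(p)$, $$q_{j,k}=\rho_{z_j\bar z_k},\qquad q_{j,0}=\overline{q_{0,j}}=P_{m,j}+\sum_{k=1}^{n+1}P_m^{(k)}\rho_{z_jz_k},\qquad q_{0,0}=\sum_{1\le j,k\le n+1}P_m^{(j)}\,\overline{P_m^{(k)}}\,\rho_{z_j\bar z_k}.$$ Assume condition (Pos): $Q_p$ is positive definite on $\mathbb C\times T_p^{1,0}\partial\Omega$, that is, $Q_p(t,\bar t)>0$ for every $t\ne0$ with $\sum_{j=1}^{n+1}\rho_{z_j}(p)t_j=0$. Then $\Omega$ is strongly $P$-convex at $p$: there are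 an open neighbourhood $U\subset V$ of $p$ and an everywhere characteristic complex analytic hypersurface $S$ in $U$ such that $S\cap\overline\Omega\cap U=\{p\}$. Here this means that $S=\{z\in U: f(z)=0\}$ for a holomorphic function $f$ on $U$ with $\partial f\neq0$ on $S$ and $P_m(z,\partial f(z))=0$ for all $z\in S$. -/

import Mathlib

open scoped ComplexConjugate

noncomputable section

/-- The complex space `ℂ^{n+1}`; its coordinates `z_1, …, z_{n+1}` are indexed by `Fin (n + 1)`. -/
abbrev CSpace (n : ℕ) : Type := Fin (n + 1) → ℂ

/-- The Wirtinger derivative `∂φ/∂z_j = (∂φ/∂x_j - i ∂φ/∂y_j) / 2`. -/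
def wirtinger {n : ℕ} (j : Fin (n + 1)) (φ : CSpace n → ℂ) (z : CSpace n) : ℂ :=
  (fderiv ℝ φ z (Pi.single j 1) - Complex.I * fderiv ℝ φ z (Pi.single j Complex.I)) / 2

/-- The conjugate Wirtinger derivative `∂φ/∂z̄_j = (∂φ/∂x_j + i ∂φ/∂y_j) / 2`. -/
def wirtingerBar {n : ℕ} (j : Fin (n + 1)) (φ : CSpace n → ℂ) (z : CSpace n) : ℂ :=
  (fderiv ℝ φ z (Pi.single j 1) + Complex.I * fderiv ℝ φ z (Pi.single j Complex.I)) / 2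

/-- The holomorphic gradient `∂φ = (∂φ/∂z_1, …, ∂φ/∂z_{n+1})`. -/
def holGrad {n : ℕ} (φ : CSpace n → ℂ) (z : CSpace n) : CSpace n :=
  fun j => wirtinger j φ z

/-- The complex partial derivative in the `j`-th variable of a holomorphic function. -/
def complexPartial {n : ℕ} (j : Fin (n + 1)) (F : CSpace n → ℂ) (w : CSpace n) : ℂ :=
  fderiv ℂ F w (Pi.single j 1)

/-- A real-valued function regarded as a complex-valued one. -/
def toComplexFun {n : ℕ} (ρ : CSpace n → ℝ) : CSpace n → ℂ := fun z => (ρ z : ℂ)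

/-- A linear partial differential operator `P(z, ∂) = ∑_{|α| ≤ m} a_α(z) (∂/∂z)^α` whose
coefficients are holomorphic on `V`; `order` is `m` and `coeff α` is `a_α`
(only the multi-indices with `|α| ≤ m` matter). -/
structure HolomorphicPDO (n : ℕ) (V : Set (CSpace n)) where
  order : ℕ
  coeff : (Fin (n + 1) → ℕ) → CSpace n → ℂ
  holomorphic_coeff : ∀ α, ∑ i, α i ≤ order → AnalyticOnNhd ℂ (coeff α) V

namespace HolomorphicPDO

variable {n : ℕ} {V : Set (CSpace n)}

/-- The principal symbol `P_m(z, ζ) = ∑_{|α| = m} a_α(z) ζ^α`. -/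
def symbol (P : HolomorphicPDO n V) (z ζ : CSpace n) : ℂ :=
  ∑ α ∈ Finset.piAntidiag (Finset.univ : Finset (Fin (n + 1))) P.order,
    P.coeff α z * ∏ i, ζ i ^ α i

/-- `P_{m,j}(z, ζ) = ∂P_m/∂z_j (z, ζ)`. -/
def symbolDz (P : HolomorphicPDO n V) (j : Fin (n + 1)) (z ζ : CSpace n) : ℂ :=
  complexPartial j (fun w => P.symbol w ζ) z

/-- `P_m^{(j)}(z, ζ) = ∂P_m/∂ζ_j (z, ζ)`. -/
def symbolDzeta (P : HolomorphicPDO n V) (j : Fin (n + 1)) (z ζ : CSpace n) : ℂ :=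
  complexPartial j (fun ξ => P.symbol z ξ) ζ

/-- The hypersurface (real or complex) with defining function `φ` is characteristic at `z`. -/
def IsCharacteristicAt (P : HolomorphicPDO n V) (φ : CSpace n → ℂ) (z : CSpace n) : Prop :=
  P.symbol z (holGrad φ z) = 0

/-- The hypersurface with defining function `φ` is simply characteristic at `z`: it is
characteristic there and `∂_ζ P_m(z, ∂φ(z)) ≠ 0`. -/
def IsSimplyCharacteristicAt (P : HolomorphicPDO n V) (φ : CSpace n → ℂ) (z : CSpace n) : Prop :=
  P.IsCharacteristicAt φ z ∧ ∃ j, P.symbolDzeta j z (holGrad φ z) ≠ 0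

end HolomorphicPDO

/-- `ρ` is a smooth defining function, near the point `p`, of the boundary of `Ω`, with
`Ω = {ρ < 0}` near `p`. -/
def IsLocalDefiningFunction {n : ℕ} (Ω : Set (CSpace n)) (p : CSpace n)
    (ρ : CSpace n → ℝ) : Prop :=
  ∃ W : Set (CSpace n), IsOpen W ∧ p ∈ W ∧ ContDiffOn ℝ (⊤ : ℕ∞) ρ W ∧
    Ω ∩ W = {z | z ∈ W ∧ ρ z < 0} ∧
    frontier Ω ∩ W = {z | z ∈ W ∧ ρ z = 0} ∧
    ∀ z ∈ frontier Ω ∩ W, holGrad (toComplexFun ρ) z ≠ 0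

/-- The holomorphic tangent space `T_p^{1,0}` of the level set of `ρ` through `p`, in
coordinates: the vectors `t` with `∑ ρ_{z_j}(p) t_j = 0`. -/
def holTangentSpace {n : ℕ} (ρ : CSpace n → ℝ) (p : CSpace n) : Set (CSpace n) :=
  {t | ∑ j, holGrad (toComplexFun ρ) p j * t j = 0}

/-- The mixed second derivative `ρ_{z_j z̄_k}`. -/
def leviCoeff {n : ℕ} (ρ : CSpace n → ℝ) (z : CSpace n) (j k : Fin (n + 1)) : ℂ :=
  wirtingerBar k (wirtinger j (toComplexFun ρ)) z

/-- The second derivative `ρ_{z_j z_k}`. -/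
def holHessCoeff {n : ℕ} (ρ : CSpace n → ℝ) (z : CSpace n) (j k : Fin (n + 1)) : ℂ :=
  wirtinger k (wirtinger j (toComplexFun ρ)) z

/-- `Ω` has smooth boundary near `p` and is strictly pseudoconvex at `p`: for a smooth defining
function the Levi form (a Hermitian form, so equal to its real part) is positive definite on the
holomorphic tangent space at `p`. -/
def IsStrictlyPseudoconvexAt {n : ℕ} (Ω : Set (CSpace n)) (p : CSpace n) : Prop :=
  ∃ ρ : CSpace n → ℝ, IsLocalDefiningFunction Ω p ρ ∧
    ∀ t ∈ holTangentSpace ρ p, t ≠ 0 →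
      0 < (∑ j, ∑ k, leviCoeff ρ p j k * t j * conj (t k)).re

section KashiwaraKawai

variable {n : ℕ} {V : Set (CSpace n)}

/-- The entry `q_{j,0}(z) = P_{m,j}(z, ∂ρ) + ∑_k P_m^{(k)}(z, ∂ρ) ρ_{z_j z_k}`, `1 ≤ j ≤ n+1`. -/
def kkMixed (P : HolomorphicPDO n V) (ρ : CSpace n → ℝ) (z : CSpace n) (j : Fin (n + 1)) : ℂ :=
  P.symbolDz j z (holGrad (toComplexFun ρ) z) +
    ∑ k, P.symbolDzeta k z (holGrad (toComplexFun ρ) z) * holHessCoeff ρ z j k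

/-- The entry `q_{0,0}(z) = ∑_{j,k} P_m^{(j)}(z, ∂ρ) conj(P_m^{(k)}(z, ∂ρ)) ρ_{z_j z̄_k}`. -/
def kkCorner (P : HolomorphicPDO n V) (ρ : CSpace n → ℝ) (z : CSpace n) : ℂ :=
  ∑ j, ∑ k, P.symbolDzeta j z (holGrad (toComplexFun ρ) z) *
    conj (P.symbolDzeta k z (holGrad (toComplexFun ρ) z)) * leviCoeff ρ z j k

/-- The coefficients `q_{j,k}(z)`, `0 ≤ j, k ≤ n+1`, of the Kashiwara–Kawai Hermitian form. -/
def kkCoeff (P : HolomorphicPDO n V) (ρ : CSpace n → ℝ) (z : CSpace n) :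
    Fin (n + 2) → Fin (n + 2) → ℂ :=
  Fin.cons (Fin.cons (kkCorner P ρ z) fun k => conj (kkMixed P ρ z k))
    fun j => Fin.cons (kkMixed P ρ z j) fun k => leviCoeff ρ z j k

/-- The Kashiwara–Kawai Hermitian form `Q_z(t, t̄) = ∑_{0 ≤ j, k ≤ n+1} q_{j,k}(z) t_j t̄_k`. -/
def kkForm (P : HolomorphicPDO n V) (ρ : CSpace n → ℝ) (z : CSpace n) (t : Fin (n + 2) → ℂ) : ℂ :=
  ∑ j, ∑ k, kkCoeff P ρ z j k * t j * conj (t k)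

/-- Condition (Pos) at `p`: the form `Q_p` is positive definite on `ℂ × T_p^{1,0}`, where
`t = (t_0, (t_1, …, t_{n+1}))`. The form is Hermitian, so its values equal their real parts. -/
def CondPos (P : HolomorphicPDO n V) (ρ : CSpace n → ℝ) (p : CSpace n) : Prop :=
  ∀ t : Fin (n + 2) → ℂ, t ≠ 0 → Fin.tail t ∈ holTangentSpace ρ p → 0 < (kkForm P ρ p t).re

end KashiwaraKawai

/-- `S` is a complex analytic hypersurface in the open set `U`, with defining function `f`. -/
def IsHypersurfaceWith {n : ℕ} (U S : Set (CSpace n)) (f : CSpace n → ℂ) : Prop :=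
  AnalyticOnNhd ℂ f U ∧ S = {z | z ∈ U ∧ f z = 0} ∧ ∀ z ∈ S, holGrad f z ≠ 0

/-- `Ω` is strongly `P`-convex at `p`: in some open neighbourhood `U` of `p` (inside the set where
the coefficients of `P` are given) there is an everywhere characteristic complex analytic
hypersurface `S` with `S ∩ Ω̄ ∩ U = {p}`. -/
def IsStronglyPConvexAt {n : ℕ} {V : Set (CSpace n)} (P : HolomorphicPDO n V)
    (Ω : Set (CSpace n)) (p : CSpace n) : Prop :=
  ∃ U S : Set (CSpace n), IsOpen U ∧ p ∈ U ∧ U ⊆ V ∧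
    (∃ f : CSpace n → ℂ, IsHypersurfaceWith U S f ∧ ∀ z ∈ S, P.IsCharacteristicAt f z) ∧
    S ∩ closure Ω ∩ U = {p}

end

/-!
The proof constructs a solution `f` of the Hamilton–Jacobi equation `P_m(z, ∂f) = 0` near `p` with
`f(p) = 0`, `∂f(p) = ∂ρ(p)` and a suitable Hessian, and takes `S = {f = 0}`.

*Choice of the Hessian.* Put `v = P_m^{(·)}(p, ∂ρ(p))`. It is nonzero because `∂Ω` is simply
characteristic at `p`, and it lies in `T_p^{1,0}` by Euler's identity. Let `b = q_{·,0}`, so that `b = ∂_z P_m + (ρ_{zz}) v`. Write the Hessian of `f`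
at `p` as `ρ_{zz} - M` with `M` symmetric. Since `ρ = ρ - 2 Re f` on `S`, the second-order part of
`ρ` on `S` is `Re M(t, t) + Λ(t, t)`, where `Λ` is the Levi form and `t ∈ T_p^{1,0}`. Differentiating
the equation at `p` gives the only constraint `M v = b`. Positivity of the Kashiwara–Kawai form says
`|b(t)|² < Λ(v, v) Λ(t, t)`, and this is exactly what is needed to extend the prescribed row `b` to
a symmetric form `M` with `Re M + Λ > 0` (`exists_symm_completion`): it is a symmetric completion
of a partially given matrix to a contraction.

*Solution of the equation.* `exists_hamiltonJacobi_solution` is the method of characteristics in the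
holomorphic category. The flow of the Hamiltonian field has to be holomorphic in complex time and
initial values. For an analytic vector field on a complex Banach space this is
`AnalyticAt.exists_flow`, proved by applying the analytic implicit function theorem to the integral
equation in the Banach space of continuous paths, where superposition with an analytic map is
analytic (`AnalyticAt.exists_superposition`). That the momentum along the characteristics is the
gradient of `f` follows from the invariance of the canonical one-form
(`eventually_canonicalForm_eq_initial`).

*Conclusion.* A second-order expansion and compactness of the unit sphere
(`eventually_pos_on_zero_set`, `eventually_pos_of_jet`) show `ρ > 0` on `S` near `p` away from `p`,
so that `S` meets the closure of `Ω` only at `p`.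
-/

open Filter Topology
open scoped ContDiff

noncomputable section

/-! ### Superposition operators on spaces of continuous functions -/

section Superposition

variable {K E G : Type*} [TopologicalSpace K] [CompactSpace K]
  [NormedAddCommGroup E] [NormedSpace ℂ E] [NormedAddCommGroup G] [NormedSpace ℂ G]

/-- The pointwise action of a continuous multilinear map on continuous functions. -/
def ContinuousMultilinearMap.pointwise (K : Type*) [TopologicalSpace K] [CompactSpace K] {n : ℕ}
    (q : ContinuousMultilinearMap ℂ (fun _ : Fin n => E) G) :
    ContinuousMultilinearMap ℂ (fun _ : Fin n => C(K, E)) C(K, G) :=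
  have upd : ∀ [DecidableEq (Fin n)] (m : Fin n → C(K, E)) (i : Fin n) (x : C(K, E)) (t : K),
      (fun j => Function.update m i x j t) = Function.update (fun j => m j t) i (x t) := by
    intro _ m i x t
    funext j
    by_cases h : j = i
    · subst h; simp
    · simp [h]
  MultilinearMap.mkContinuous
    { toFun := fun u => ⟨fun t => q fun i => u i t, by fun_prop⟩
      map_update_add' := by
        intro _ m i x y
        ext t
        simp [upd]
      map_update_smul' := by
        intro _ m i c x
        ext t
        simp [upd] }
    ‖q‖ (by
      intro m
      refine (ContinuousMap.norm_le _ (by positivity)).2 fun t => ?_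
      refine (q.le_opNorm _).trans ?_
      gcongr with i
      exact (m i).norm_coe_le_norm t)

@[simp]
theorem ContinuousMultilinearMap.pointwise_apply {n : ℕ}
    (q : ContinuousMultilinearMap ℂ (fun _ : Fin n => E) G) (u : Fin n → C(K, E)) (t : K) :
    q.pointwise K u t = q fun i => u i t := rfl

theorem ContinuousMultilinearMap.norm_pointwise_le {n : ℕ}
    (q : ContinuousMultilinearMap ℂ (fun _ : Fin n => E) G) : ‖q.pointwise K‖ ≤ ‖q‖ :=
  ContinuousMultilinearMap.opNorm_le_bound (norm_nonneg q) fun m =>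
    (ContinuousMap.norm_le _ (by positivity)).2 fun t => (q.le_opNorm _).trans (by
      gcongr with i
      exact (m i).norm_coe_le_norm t)

variable [CompleteSpace G]

/-- Superposition with an analytic map is analytic: it is the sum of the pointwise power series,
which converges at least where the given one does. -/
theorem AnalyticAt.exists_superposition {X : E → G} {x₀ : E} (hX : AnalyticAt ℂ X x₀) :
    ∃ N : C(K, E) → C(K, G), AnalyticAt ℂ N (ContinuousMap.const K x₀) ∧
      ∀ᶠ u in 𝓝 (ContinuousMap.const K x₀), ∀ t, N u t = X (u t) := by
  obtain ⟨q, r, hq⟩ := hX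
  let Q : FormalMultilinearSeries ℂ C(K, E) C(K, G) := fun n => (q n).pointwise K
  have hrad : r ≤ Q.radius := by
    refine hq.r_le.trans (ENNReal.le_of_forall_nnreal_lt fun s hs => ?_)
    obtain ⟨C, -, hC⟩ := q.norm_mul_pow_le_of_lt_radius hs
    refine Q.le_radius_of_bound C fun n => le_trans ?_ (hC n)
    gcongr
    exact ContinuousMultilinearMap.norm_pointwise_le _
  have hQ := Q.hasFPowerSeriesOnBall (hq.r_pos.trans_le hrad)
  refine ⟨fun u => Q.sum (u - ContinuousMap.const K x₀), ?_, ?_⟩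
  · have h := hQ.comp_sub (ContinuousMap.const K x₀)
    rw [zero_add] at h
    exact h.analyticAt
  · filter_upwards [Metric.eball_mem_nhds (ContinuousMap.const K x₀) hq.r_pos] with u hu t
    have h1 : u - ContinuousMap.const K x₀ ∈ Metric.eball (0 : C(K, E)) r := by
      simpa [edist_eq_enorm_sub] using hu
    have h2 : u t - x₀ ∈ Metric.eball (0 : E) r := by
      have h3 : ‖u t - x₀‖ₑ ≤ ‖u - ContinuousMap.const K x₀‖ₑ := by
        rw [enorm_le_iff_norm_le]
        exact (u - ContinuousMap.const K x₀).norm_coe_le_norm t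
      simp only [Metric.mem_eball, edist_zero_right] at h1 ⊢
      exact h3.trans_lt h1
    have s1 := (hQ.hasSum (Metric.eball_subset_eball hrad h1))
    rw [zero_add] at s1
    have s2 := s1.mapL ((ContinuousMap.evalCLM ℂ t : C(K, G) →L[ℂ] G))
    have s3 := hq.hasSum h2
    rw [add_sub_cancel] at s3
    exact s2.unique s3

end Superposition

/-! ### Analytic dependence of flows on time and initial value -/

section Flow

variable {E : Type*} [NormedAddCommGroup E] [NormedSpace ℂ E]

/-- The primitive vanishing at `0` of a continuous function on `[0, 1]`, as a bounded operator. -/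
def primitiveCLM (E : Type*) [NormedAddCommGroup E] [NormedSpace ℂ E] :
    C(unitInterval, E) →L[ℂ] C(unitInterval, E) :=
  have hc : ∀ u : C(unitInterval, E), Continuous fun σ : ℝ => u (Set.projIcc 0 1 zero_le_one σ) :=
    fun u => u.continuous.comp continuous_projIcc
  LinearMap.mkContinuous
    { toFun := fun u => ⟨fun t => ∫ σ in (0 : ℝ)..t, u (Set.projIcc 0 1 zero_le_one σ),
        (intervalIntegral.continuous_primitive
          (fun a b => (hc u).intervalIntegrable a b) 0).comp continuous_subtype_val⟩
      map_add' := by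
        intro u w
        ext t
        exact intervalIntegral.integral_add ((hc u).intervalIntegrable _ _)
          ((hc w).intervalIntegrable _ _)
      map_smul' := by
        intro c u
        ext t
        exact intervalIntegral.integral_smul c _ }
    1 (by
      intro u
      refine (ContinuousMap.norm_le _ (by positivity)).2 fun t => ?_
      refine (intervalIntegral.norm_integral_le_of_norm_le_const
        (C := ‖u‖) fun σ _ => u.norm_coe_le_norm _).trans ?_
      have h0 := t.2.1
      have h1 := t.2.2
      rw [sub_zero, abs_of_nonneg h0, one_mul]
      exact mul_le_of_le_one_right (norm_nonneg _) h1)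

theorem primitiveCLM_apply (u : C(unitInterval, E)) (t : unitInterval) :
    primitiveCLM E u t = ∫ σ in (0 : ℝ)..t, u (Set.projIcc 0 1 zero_le_one σ) := rfl

variable [CompleteSpace E]

/-- Solutions of `x' = s X(x)`, `x(0) = y` on the unit interval depend analytically on `(s, y)`.
They are obtained, as displacements `u = x - y`, from the implicit function theorem applied to the
integral equation, whose derivative in `u` at `s = 0` is the identity. -/
theorem AnalyticAt.exists_path_family {X : E → E} {x₀ : E} (hX : AnalyticAt ℂ X x₀) :
    ∃ U : ℂ × E → C(unitInterval, E), AnalyticAt ℂ U (0, x₀) ∧ U (0, x₀) = 0 ∧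
      (∀ᶠ q in 𝓝 ((0 : ℂ), x₀), Continuous (fun t => X (q.2 + U q t)) ∧ ∀ t : unitInterval, U q t =
        q.1 • ∫ σ in (0 : ℝ)..t, X (q.2 + U q (Set.projIcc 0 1 zero_le_one σ))) ∧
      ∀ᶠ r in 𝓝 (((0 : ℂ), x₀), (0 : C(unitInterval, E))), (∀ t : unitInterval, r.2 t =
        r.1.1 • ∫ σ in (0 : ℝ)..t, X (r.1.2 + r.2 (Set.projIcc 0 1 zero_le_one σ))) →
          U r.1 = r.2 := by
  obtain ⟨N, hN, hNX⟩ := hX.exists_superposition (K := unitInterval)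
  let A : (ℂ × E) × C(unitInterval, E) →L[ℂ] C(unitInterval, E) :=
    (ContinuousLinearMap.const (R := ℂ) (M := E) unitInterval).comp
      ((ContinuousLinearMap.snd ℂ ℂ E).comp (ContinuousLinearMap.fst ℂ _ _)) +
      ContinuousLinearMap.snd ℂ _ _
  have hA : ∀ r t, A r t = r.1.2 + r.2 t := fun r t => rfl
  have hA0 : A ((0, x₀), 0) = ContinuousMap.const unitInterval x₀ := by
    ext t; simp [hA]
  let B : (ℂ × E) × C(unitInterval, E) → C(unitInterval, E) := fun r => primitiveCLM E (N (A r))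
  have hB : AnalyticAt ℂ B ((0, x₀), 0) := by
    refine (primitiveCLM E).analyticAt _ |>.comp (AnalyticAt.comp ?_ (A.analyticAt _))
    rwa [hA0]
  let F : (ℂ × E) × C(unitInterval, E) → C(unitInterval, E) := fun r => r.2 - r.1.1 • B r
  have hF : AnalyticAt ℂ F ((0, x₀), 0) :=
    analyticAt_snd.sub (((analyticAt_fst.comp analyticAt_fst)).smul hB)
  have hF0 : F ((0, x₀), 0) = 0 := by simp [F]
  have cdf : ContDiffAt ℂ ω F ((0, x₀), 0) := hF.contDiffAt
  have hder : fderiv ℂ F ((0, x₀), 0) ∘L .inr ℂ (ℂ × E) C(unitInterval, E) = .id ℂ _ := by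
    have h1 : HasFDerivAt (fun r : (ℂ × E) × C(unitInterval, E) => r.1.1)
      ((ContinuousLinearMap.fst ℂ ℂ E).comp (ContinuousLinearMap.fst ℂ _ _)) ((0, x₀), 0) :=
      hasFDerivAt_fst.comp _ hasFDerivAt_fst
    have h2 := (hasFDerivAt_snd (𝕜 := ℂ) (E := ℂ × E) (F := C(unitInterval, E))
      (p := ((0, x₀), 0))).sub (h1.smul hB.differentiableAt.hasFDerivAt)
    have h3 : HasFDerivAt F _ ((0, x₀), 0) := h2
    rw [h3.fderiv]
    ext u t
    simp
  have hinv : (fderiv ℂ F ((0, x₀), 0) ∘L .inr ℂ (ℂ × E) C(unitInterval, E)).IsInvertible := by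
    rw [hder]
    exact ⟨ContinuousLinearEquiv.refl ℂ _, rfl⟩
  let U := cdf.implicitFunction (by simp) hinv
  have hU : AnalyticAt ℂ U (0, x₀) :=
    (cdf.contDiffAt_implicitFunction (by simp) hinv).analyticAt
  have hU0 : U (0, x₀) = 0 := cdf.implicitFunction_apply_self (by simp) hinv
  have key : ∀ᶠ r in 𝓝 (((0 : ℂ), x₀), (0 : C(unitInterval, E))), ∀ t, N (A r) t = X (A r t) := by
    have := A.continuous.tendsto ((0, x₀), 0)
    rw [hA0] at this
    exact this.eventually hNX
  have hFe : ∀ r t, F r t = r.2 t - r.1.1 • ∫ σ in (0 : ℝ)..t,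
      N (A r) (Set.projIcc 0 1 zero_le_one σ) := fun r t => rfl
  refine ⟨U, hU, hU0, ?_, ?_⟩
  · have h1 := cdf.eventually_apply_implicitFunction (by simp) hinv
    have h2 : Tendsto (fun q => (q, U q)) (𝓝 (0, x₀)) (𝓝 (((0 : ℂ), x₀), 0)) := by
      have := (continuousAt_id.prodMk hU.continuousAt).tendsto
      rwa [hU0] at this
    filter_upwards [h1, h2.eventually key] with q hq hk
    refine ⟨((N (A (q, U q))).continuous).congr fun t => hk t, fun t => ?_⟩
    have h3 := DFunLike.congr_fun hq t
    change F (q, U q) t = _ at h3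
    rw [hF0, hFe] at h3
    have h4 := sub_eq_zero.1 h3
    simpa only [hk, hA] using h4
  · filter_upwards [cdf.eventually_apply_eq_iff_implicitFunction (by simp) hinv, key]
      with r hr hk h
    refine hr.1 ?_
    rw [hF0]
    ext t
    rw [hFe]
    simp only [hk, hA]
    exact sub_eq_zero.2 (h t)

/-- The local flow of an analytic vector field on a complex Banach space, for complex time,
is analytic in time and initial value jointly. -/
theorem AnalyticAt.exists_flow {X : E → E} {x₀ : E} (hX : AnalyticAt ℂ X x₀) :
    ∃ Φ : ℂ × E → E, AnalyticAt ℂ Φ (0, x₀) ∧ (∀ᶠ y in 𝓝 x₀, Φ (0, y) = y) ∧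
      ∀ᶠ q in 𝓝 ((0 : ℂ), x₀), fderiv ℂ Φ q (1, 0) = X (Φ q) := by
  obtain ⟨U, hU, hU0, hint, huniq⟩ := hX.exists_path_family
  let Φ : ℂ × E → E := fun q => q.2 + U q 1
  have hΦ : AnalyticAt ℂ Φ (0, x₀) :=
    analyticAt_snd.add
      (((ContinuousMap.evalCLM ℂ (1 : unitInterval) : C(unitInterval, E) →L[ℂ] E).analyticAt
        (U (0, x₀))).comp hU)
  have hΦ0 : ∀ᶠ y in 𝓝 x₀, Φ (0, y) = y := by
    have ht : Tendsto (fun y : E => ((0 : ℂ), y)) (𝓝 x₀) (𝓝 (0, x₀)) :=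
      (Continuous.prodMk_right (0 : ℂ)).tendsto x₀
    filter_upwards [ht.eventually hint] with y hy
    have := hy.2 1
    simp only [zero_smul] at this
    simp [Φ, this]
  have hbase : Φ (0, x₀) = x₀ := hΦ0.self_of_nhds
  -- Running for time `τ s` is the same as running for time `s` and stopping at parameter `τ`.
  have hscale : ∀ᶠ q in 𝓝 ((0 : ℂ), x₀), ∀ τ : unitInterval,
      U ((τ : ℝ) • q.1, q.2) 1 = U q τ := by
    obtain ⟨ε, hε, hball⟩ := Metric.eventually_nhds_iff.1 huniq
    have hsmall : ∀ᶠ q in 𝓝 ((0 : ℂ), x₀), ‖U q‖ < ε := by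
      have := hU.continuousAt.norm.tendsto
      rw [hU0, norm_zero] at this
      exact this.eventually (gt_mem_nhds hε)
    filter_upwards [hsmall, hint, Metric.ball_mem_nhds _ hε] with q hq hi hqε τ
    let w : C(unitInterval, E) := (U q).comp ⟨fun t => τ * t, by fun_prop⟩
    have hw : ∀ t, w t = U q (τ * t) := fun t => rfl
    have hτ0 := τ.2.1
    have hτ1 := τ.2.2
    have hwU : U ((τ : ℝ) • q.1, q.2) = w := by
      refine hball (y := (((τ : ℝ) • q.1, q.2), w)) ?_ ?_
      · rw [Metric.mem_ball, Prod.dist_eq, max_lt_iff] at hqε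
        simp only [Prod.dist_eq, max_lt_iff]
        refine ⟨⟨?_, hqε.2⟩, ?_⟩
        · refine lt_of_le_of_lt ?_ hqε.1
          rw [dist_zero_right, dist_zero_right, norm_smul, Real.norm_of_nonneg hτ0]
          exact mul_le_of_le_one_left (norm_nonneg _) hτ1
        · rw [dist_zero_right]
          refine lt_of_le_of_lt ?_ hq
          exact (ContinuousMap.norm_le _ (norm_nonneg _)).2 fun t => (U q).norm_coe_le_norm _
      · intro t
        have h1 := hi.2 (τ * t)
        have h2 := intervalIntegral.smul_integral_comp_mul_left (a := 0) (b := t)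
          (fun σ => X (q.2 + U q (Set.projIcc 0 1 zero_le_one σ))) (τ : ℝ)
        rw [mul_zero] at h2
        rw [hw, h1, Set.Icc.coe_mul, ← h2, smul_comm, ← smul_assoc]
        congr 1
        refine intervalIntegral.integral_congr fun σ hσ => ?_
        rw [Set.uIcc_of_le t.2.1] at hσ
        have hσ1 : σ ∈ Set.Icc (0 : ℝ) 1 := ⟨hσ.1, hσ.2.trans t.2.2⟩
        have hσ2 : (τ : ℝ) * σ ∈ Set.Icc (0 : ℝ) 1 :=
          ⟨mul_nonneg hτ0 hσ.1, mul_le_one₀ hτ1 hσ.1 hσ1.2⟩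
        simp only [hw]
        rw [Set.projIcc_of_mem _ hσ1, Set.projIcc_of_mem _ hσ2]
        rfl
    rw [hwU, hw, mul_one]
  -- Differentiating in `τ` at `τ = 1` gives the differential equation multiplied by `s`.
  have hmul : ∀ᶠ q in 𝓝 ((0 : ℂ), x₀), q.1 • fderiv ℂ Φ q (1, 0) = q.1 • X (Φ q) := by
    filter_upwards [hscale, hint, hΦ.eventually_analyticAt] with q hs hi ha
    let g : ℝ → E := fun σ => X (q.2 + U q (Set.projIcc 0 1 zero_le_one σ))
    have hg : Continuous g := hi.1.comp continuous_projIcc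
    have d1 : HasDerivAt (fun τ : ℝ => q.2 + q.1 • ∫ σ in (0 : ℝ)..τ, g σ) (q.1 • g 1) 1 := by
      have := intervalIntegral.integral_hasDerivAt_right (hg.intervalIntegrable 0 1)
        hg.stronglyMeasurable.stronglyMeasurableAtFilter hg.continuousAt
      exact (this.const_smul q.1).const_add q.2
    have d2 : HasDerivAt (fun τ : ℝ => Φ (τ • q.1, q.2)) (fderiv ℂ Φ q (q.1, 0)) 1 := by
      have e1 : HasDerivAt (fun τ : ℝ => (τ • q.1, q.2)) (q.1, (0 : E)) 1 := by
        have := (hasDerivAt_id (1 : ℝ)).smul_const q.1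
        simp only [one_smul] at this
        exact this.prodMk (hasDerivAt_const _ _)
      have e2 : HasFDerivAt Φ ((fderiv ℂ Φ q).restrictScalars ℝ) (((1 : ℝ) • q.1, q.2)) := by
        rw [one_smul]
        exact ha.differentiableAt.hasFDerivAt.restrictScalars ℝ
      exact e2.comp_hasDerivAt (1 : ℝ) e1
    have d3 : HasDerivWithinAt (fun τ : ℝ => Φ (τ • q.1, q.2)) (q.1 • g 1) (Set.Icc 0 1) 1 := by
      refine d1.hasDerivWithinAt.congr (fun τ hτ => ?_) ?_
      · have h1 := hs ⟨τ, hτ⟩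
        have h2 := hi.2 ⟨τ, hτ⟩
        simp only [Φ]
        rw [h1, h2]
      · have h1 := hs 1
        have h2 := hi.2 1
        simp only [Set.Icc.coe_one] at h1 h2
        simp only [Φ]
        rw [h1, h2]
    have h4 := (uniqueDiffOn_Icc (zero_lt_one' ℝ) 1 (by simp)).eq_deriv _
      d2.hasDerivWithinAt d3
    have h5 : (q.1, (0 : E)) = q.1 • ((1 : ℂ), (0 : E)) := by simp
    rw [h5, map_smul] at h4
    rw [h4]
    simp only [g, Φ]
    rw [Set.projIcc_right]
    rfl
  refine ⟨Φ, hΦ, hΦ0, ?_⟩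
  have hcontD : ∀ᶠ q in 𝓝 ((0 : ℂ), x₀),
      ContinuousAt (fun q => fderiv ℂ Φ q (1, 0) - X (Φ q)) q := by
    have h1 : AnalyticAt ℂ (fun q => fderiv ℂ Φ q (1, 0) - X (Φ q)) (0, x₀) := by
      refine AnalyticAt.sub ?_ ?_
      · exact ((ContinuousLinearMap.apply ℂ E ((1 : ℂ), (0 : E))).analyticAt _).comp hΦ.fderiv
      · refine AnalyticAt.comp ?_ hΦ
        rwa [hbase]
    exact h1.eventually_analyticAt.mono fun q hq => hq.continuousAt
  filter_upwards [hmul.eventually_nhds, hcontD] with q hq hc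
  by_cases hq0 : q.1 = 0
  · -- At time `0` the factor `s` is cancelled by continuity.
    have ht : Tendsto (fun s : ℂ => (s, q.2)) (𝓝[≠] 0) (𝓝 q) := by
      have : Tendsto (fun s : ℂ => (s, q.2)) (𝓝 0) (𝓝 (0, q.2)) :=
        (Continuous.prodMk_left q.2).tendsto 0
      rw [← hq0] at this
      rw [← hq0]
      exact this.mono_left nhdsWithin_le_nhds
    have h1 : Tendsto (fun s : ℂ => fderiv ℂ Φ (s, q.2) (1, 0) - X (Φ (s, q.2))) (𝓝[≠] 0)
        (𝓝 (fderiv ℂ Φ q (1, 0) - X (Φ q))) := hc.tendsto.comp ht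
    have h2 : ∀ᶠ s in 𝓝[≠] (0 : ℂ), fderiv ℂ Φ (s, q.2) (1, 0) - X (Φ (s, q.2)) = 0 := by
      filter_upwards [ht.eventually hq, self_mem_nhdsWithin] with s hs hs0
      exact sub_eq_zero.2 (smul_right_injective E hs0 hs)
    have h3 := tendsto_nhds_unique (h1.congr' h2) tendsto_const_nhds
    exact sub_eq_zero.1 h3
  · exact smul_right_injective E hq0 hq.self_of_nhds

end Flow

/-! ### Calculus with the coordinate pairing -/

section Pairing

variable {ι : Type*} [Fintype ι] {M : Type*} [NormedAddCommGroup M] [NormedSpace ℂ M]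

theorem AnalyticAt.dotProduct {a b : M → ι → ℂ} {x : M} (ha : AnalyticAt ℂ a x)
    (hb : AnalyticAt ℂ b x) : AnalyticAt ℂ (fun q => a q ⬝ᵥ b q) x :=
  Finset.analyticAt_fun_sum _ fun i _ =>
    (analyticAt_pi_iff.1 ha i).mul (analyticAt_pi_iff.1 hb i)

theorem fderiv_dotProduct_apply {a b : M → ι → ℂ} {x : M} (ha : DifferentiableAt ℂ a x)
    (hb : DifferentiableAt ℂ b x) (h : M) :
    fderiv ℂ (fun q => a q ⬝ᵥ b q) x h = fderiv ℂ a x h ⬝ᵥ b x + a x ⬝ᵥ fderiv ℂ b x h := by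
  have ha' := hasFDerivAt_pi'.1 ha.hasFDerivAt
  have hb' := hasFDerivAt_pi'.1 hb.hasFDerivAt
  have : HasFDerivAt (fun q => ∑ i, a q i * b q i) _ x :=
    HasFDerivAt.fun_sum (u := Finset.univ) fun i _ => (ha' i).mul (hb' i)
  rw [show (fun q => a q ⬝ᵥ b q) = fun q => ∑ i, a q i * b q i from rfl, this.fderiv]
  simp only [dotProduct, sum_apply, ← Finset.sum_add_distrib]
  refine Finset.sum_congr rfl fun i _ => ?_
  simp
  ring

/-- A function of time and position whose time derivative vanishes is locally constant in time. -/
theorem AnalyticAt.eventually_eq_initial {G : Type*} [NormedAddCommGroup G] [NormedSpace ℂ G]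
    [CompleteSpace G] {k : ℂ × M → G} {x₀ : M} (hk : AnalyticAt ℂ k (0, x₀))
    (h : ∀ᶠ q in 𝓝 ((0 : ℂ), x₀), fderiv ℂ k q (1, 0) = 0) :
    ∀ᶠ q in 𝓝 ((0 : ℂ), x₀), k q = k (0, q.2) := by
  obtain ⟨ε, hε, hball⟩ := Metric.eventually_nhds_iff_ball.1 (h.and hk.eventually_analyticAt)
  filter_upwards [Metric.ball_mem_nhds _ hε] with q hq
  rw [← ball_prod_same] at hq hball
  have hd : ∀ s ∈ Metric.ball (0 : ℂ) ε,
      HasDerivWithinAt (fun s => k (s, q.2)) 0 (Metric.ball 0 ε) s := by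
    intro s hs
    obtain ⟨h0, ha⟩ := hball (s, q.2) ⟨hs, hq.2⟩
    have e := ha.differentiableAt.hasFDerivAt.comp_hasDerivAt s
      ((hasDerivAt_id s).prodMk (hasDerivAt_const s q.2))
    rw [h0] at e
    exact e.hasDerivWithinAt
  have := (convex_ball (0 : ℂ) ε).norm_image_sub_le_of_norm_hasDerivWithin_le (C := 0)
    hd (by simp) (Metric.mem_ball_self hε) hq.1
  rw [zero_mul, norm_le_zero_iff, sub_eq_zero] at this
  exact this

end Pairing

/-! ### The Hamilton–Jacobi equation -/

section HamiltonJacobi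

variable {ι : Type*} [Fintype ι] [DecidableEq ι]

/-- The gradient in the position variables of a function of position and momentum. -/
def gradPos (H : (ι → ℂ) × (ι → ℂ) → ℂ) (w : (ι → ℂ) × (ι → ℂ)) : ι → ℂ :=
  fun j => fderiv ℂ H w (Pi.single j 1, 0)

/-- The gradient in the momentum variables of a function of position and momentum. -/
def gradMom (H : (ι → ℂ) × (ι → ℂ) → ℂ) (w : (ι → ℂ) × (ι → ℂ)) : ι → ℂ :=
  fun j => fderiv ℂ H w (0, Pi.single j 1)

/-- The Hamiltonian vector field `(∂_ζ H, -∂_z H)`. -/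
def hamiltonField (H : (ι → ℂ) × (ι → ℂ) → ℂ) (w : (ι → ℂ) × (ι → ℂ)) : (ι → ℂ) × (ι → ℂ) :=
  (gradMom H w, -gradPos H w)

theorem clm_apply_eq_dotProduct (A : (ι → ℂ) →L[ℂ] ℂ) (a : ι → ℂ) :
    A a = (fun j => A (Pi.single j 1)) ⬝ᵥ a := by
  conv_lhs => rw [pi_eq_sum_univ' a]
  simp [dotProduct, mul_comm]

variable {H : (ι → ℂ) × (ι → ℂ) → ℂ}

theorem fderiv_eq_gradPos_add_gradMom (w : (ι → ℂ) × (ι → ℂ)) (a b : ι → ℂ) :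
    fderiv ℂ H w (a, b) = gradPos H w ⬝ᵥ a + gradMom H w ⬝ᵥ b := by
  have h1 := clm_apply_eq_dotProduct ((fderiv ℂ H w).comp (.inl ℂ _ _)) a
  have h2 := clm_apply_eq_dotProduct ((fderiv ℂ H w).comp (.inr ℂ _ _)) b
  simp only [ContinuousLinearMap.comp_apply, ContinuousLinearMap.inl_apply,
    ContinuousLinearMap.inr_apply] at h1 h2
  have h3 : (a, b) = (a, (0 : ι → ℂ)) + ((0 : ι → ℂ), b) := by simp
  rw [h3, map_add, h1, h2]
  rfl

theorem AnalyticAt.gradPos {w : (ι → ℂ) × (ι → ℂ)} (hH : AnalyticAt ℂ H w) :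
    AnalyticAt ℂ (gradPos H) w :=
  analyticAt_pi_iff.2 fun j => ((ContinuousLinearMap.apply ℂ ℂ
    ((Pi.single j 1, 0) : (ι → ℂ) × (ι → ℂ))).analyticAt _).comp hH.fderiv

theorem AnalyticAt.gradMom {w : (ι → ℂ) × (ι → ℂ)} (hH : AnalyticAt ℂ H w) :
    AnalyticAt ℂ (gradMom H) w :=
  analyticAt_pi_iff.2 fun j => ((ContinuousLinearMap.apply ℂ ℂ
    ((0, Pi.single j 1) : (ι → ℂ) × (ι → ℂ))).analyticAt _).comp hH.fderiv

theorem AnalyticAt.hamiltonField {w : (ι → ℂ) × (ι → ℂ)} (hH : AnalyticAt ℂ H w) :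
    AnalyticAt ℂ (hamiltonField H) w :=
  hH.gradMom.prod hH.gradPos.neg

/-- Along a family of null bicharacteristics of a homogeneous Hamiltonian, the pullback of the
canonical one-form `ζ · dz` to the parameter space is invariant in time. -/
theorem eventually_canonicalForm_eq_initial {x₀ : ι → ℂ} {Z ξ : ℂ × (ι → ℂ) → ι → ℂ}
    (hZ : AnalyticAt ℂ Z (0, x₀)) (hξ : AnalyticAt ℂ ξ (0, x₀))
    (hH : AnalyticAt ℂ H (Z (0, x₀), ξ (0, x₀)))
    (hZt : ∀ᶠ q in 𝓝 ((0 : ℂ), x₀), fderiv ℂ Z q (1, 0) = gradMom H (Z q, ξ q))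
    (hξt : ∀ᶠ q in 𝓝 ((0 : ℂ), x₀), fderiv ℂ ξ q (1, 0) = -gradPos H (Z q, ξ q))
    (hnull : ∀ᶠ q in 𝓝 ((0 : ℂ), x₀), H (Z q, ξ q) = 0)
    (heul : ∀ᶠ q in 𝓝 ((0 : ℂ), x₀), ξ q ⬝ᵥ gradMom H (Z q, ξ q) = 0) :
    ∀ᶠ q in 𝓝 ((0 : ℂ), x₀), ∀ η : ι → ℂ,
      ξ q ⬝ᵥ fderiv ℂ Z q (0, η) = ξ (0, q.2) ⬝ᵥ fderiv ℂ Z (0, q.2) (0, η) := by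
  have hcomp : AnalyticAt ℂ (fun q => gradMom H (Z q, ξ q)) (0, x₀) :=
    hH.gradMom.comp (f := fun q => (Z q, ξ q)) (hZ.prod hξ)
  have hHc : AnalyticAt ℂ (fun q => H (Z q, ξ q)) (0, x₀) :=
    hH.comp (f := fun q => (Z q, ξ q)) (hZ.prod hξ)
  have hZH : ∀ᶠ q in 𝓝 ((0 : ℂ), x₀), AnalyticAt ℂ H (Z q, ξ q) :=
    (hZ.continuousAt.prodMk hξ.continuousAt).eventually hH.eventually_analyticAt
  have main : ∀ η : ι → ℂ, ∀ᶠ q in 𝓝 ((0 : ℂ), x₀),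
      ξ q ⬝ᵥ fderiv ℂ Z q (0, η) = ξ (0, q.2) ⬝ᵥ fderiv ℂ Z (0, q.2) (0, η) := by
    intro η
    have hZη : ∀ q, AnalyticAt ℂ Z q → ∀ v, AnalyticAt ℂ (fun q => fderiv ℂ Z q v) q :=
      fun q hq v => ((ContinuousLinearMap.apply ℂ (ι → ℂ) v).analyticAt _).comp hq.fderiv
    refine AnalyticAt.eventually_eq_initial (hξ.dotProduct (hZη _ hZ (0, η))) ?_
    filter_upwards [hZ.eventually_analyticAt, hξ.eventually_analyticAt, hcomp.eventually_analyticAt,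
      hZH, hZt.eventually_nhds, hξt, hnull.eventually_nhds, heul.eventually_nhds]
      with q aZ aξ ac aH eZ eξ en ee
    rw [fderiv_dotProduct_apply aξ.differentiableAt (hZη _ aZ (0, η)).differentiableAt, eξ]
    have hsnd : ∀ v w, fderiv ℂ (fun q => fderiv ℂ Z q v) q w = fderiv ℂ (fderiv ℂ Z) q w v := by
      intro v w
      have := (ContinuousLinearMap.apply ℂ (ι → ℂ) v).hasFDerivAt.comp q
        aZ.fderiv.differentiableAt.hasFDerivAt
      have h2 : HasFDerivAt (fun q => fderiv ℂ Z q v) _ q := this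
      rw [h2.fderiv]
      rfl
    -- Mixed second derivatives of the positions are derivatives of the velocity field.
    have h1 : fderiv ℂ (fun q => fderiv ℂ Z q (0, η)) q (1, 0)
        = fderiv ℂ (fun q => gradMom H (Z q, ξ q)) q (0, η) := by
      rw [hsnd, aZ.contDiffAt.isSymmSndFDerivAt_of_omega, ← hsnd]
      have : (fun q => fderiv ℂ Z q (1, 0)) =ᶠ[𝓝 q] fun q => gradMom H (Z q, ξ q) := eZ
      rw [this.fderiv_eq]
    have h2 : fderiv ℂ ξ q (0, η) ⬝ᵥ gradMom H (Z q, ξ q)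
        + ξ q ⬝ᵥ fderiv ℂ (fun q => gradMom H (Z q, ξ q)) q (0, η) = 0 := by
      rw [← fderiv_dotProduct_apply aξ.differentiableAt ac.differentiableAt]
      have : (fun q => ξ q ⬝ᵥ gradMom H (Z q, ξ q)) =ᶠ[𝓝 q] fun _ => 0 := ee
      rw [this.fderiv_eq]
      simp
    have h3 : gradPos H (Z q, ξ q) ⬝ᵥ fderiv ℂ Z q (0, η)
        + gradMom H (Z q, ξ q) ⬝ᵥ fderiv ℂ ξ q (0, η) = 0 := by
      rw [← fderiv_eq_gradPos_add_gradMom]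
      have e1 : HasFDerivAt (fun q => H (Z q, ξ q)) _ q :=
        aH.differentiableAt.hasFDerivAt.comp q
          (aZ.differentiableAt.hasFDerivAt.prodMk aξ.differentiableAt.hasFDerivAt)
      have e2 : (fun q => H (Z q, ξ q)) =ᶠ[𝓝 q] fun _ => 0 := en
      have e3 := e1.fderiv
      rw [e2.fderiv_eq] at e3
      have e4 := DFunLike.congr_fun e3 (0, η)
      simpa using e4.symm
    rw [h1, neg_dotProduct]
    rw [dotProduct_comm (gradMom H (Z q, ξ q))] at h3
    linear_combination h2 - h3
  have hall := eventually_all.2 fun j : ι => main (Pi.single j 1)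
  filter_upwards [hall] with q hq η
  have e : ∀ q' : ℂ × (ι → ℂ), ξ q' ⬝ᵥ fderiv ℂ Z q' (0, η)
      = ∑ j, η j * (ξ q' ⬝ᵥ fderiv ℂ Z q' (0, Pi.single j 1)) := by
    intro q'
    have h1 : ((0 : ℂ), η) = ∑ j, η j • ((0 : ℂ), (Pi.single j 1 : ι → ℂ)) := by
      have h2 := congrArg (LinearMap.inr ℂ ℂ (ι → ℂ)) (pi_eq_sum_univ' η)
      rw [map_sum] at h2
      simp only [map_smul, LinearMap.inr_apply] at h2
      exact h2
    conv_lhs => rw [h1]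
    simp only [map_sum, map_smul, dotProduct_sum, dotProduct_smul, smul_eq_mul]
  rw [e, e]
  exact Finset.sum_congr rfl fun j _ => by rw [hq j]

/-- The Hamiltonian is conserved along its flow. -/
theorem fderiv_apply_hamiltonField (w : (ι → ℂ) × (ι → ℂ)) :
    fderiv ℂ H w (hamiltonField H w) = 0 := by
  rw [hamiltonField, fderiv_eq_gradPos_add_gradMom, dotProduct_neg, dotProduct_comm]
  exact add_neg_cancel _

/-- The affine momentum field `ζ₀ + F (y - p)` can be corrected, in a direction `ℓ` transverse to
the characteristic direction, to lie on the zero set of the Hamiltonian. When the first-order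
compatibility condition holds, the correction vanishes to second order. -/
theorem exists_null_momentum {p ζ₀ ℓ : ι → ℂ} (hH : AnalyticAt ℂ H (p, ζ₀))
    (h0 : H (p, ζ₀) = 0) (hℓ : ℓ ⬝ᵥ gradMom H (p, ζ₀) = 1) {F : Matrix ι ι ℂ} (hF : F.IsSymm)
    (hcomp : gradPos H (p, ζ₀) + F.mulVec (gradMom H (p, ζ₀)) = 0) :
    ∃ lam : (ι → ℂ) → ℂ, AnalyticAt ℂ lam p ∧ lam p = 0 ∧ fderiv ℂ lam p = 0 ∧
      ∀ᶠ y in 𝓝 p, H (y, ζ₀ + F.mulVec (y - p) + lam y • ℓ) = 0 := by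
  let L : (ι → ℂ) →L[ℂ] (ι → ℂ) := F.mulVecLin.toContinuousLinearMap
  have hL : ∀ v, F.mulVec v = L v := fun v => rfl
  let a : (ι → ℂ) × ℂ → (ι → ℂ) × (ι → ℂ) := fun r => (r.1, ζ₀ + L (r.1 - p) + r.2 • ℓ)
  have ha : AnalyticAt ℂ a (p, 0) := by
    refine analyticAt_fst.prod ((analyticAt_const.add ?_).add (analyticAt_snd.smul analyticAt_const))
    exact (L.analyticAt _).comp (analyticAt_fst.sub analyticAt_const)
  have ha0 : a (p, 0) = (p, ζ₀) := by simp [a]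
  have had : HasFDerivAt a ((ContinuousLinearMap.fst ℂ _ ℂ).prod
      (L.comp (ContinuousLinearMap.fst ℂ _ ℂ) +
        (ContinuousLinearMap.snd ℂ (ι → ℂ) ℂ).smulRight ℓ)) (p, 0) := by
    have h1 : HasFDerivAt (fun r : (ι → ℂ) × ℂ => r.1) (ContinuousLinearMap.fst ℂ (ι → ℂ) ℂ)
      (p, 0) := hasFDerivAt_fst
    have h2 : HasFDerivAt (fun r : (ι → ℂ) × ℂ => r.2) (ContinuousLinearMap.snd ℂ (ι → ℂ) ℂ)
      (p, 0) := hasFDerivAt_snd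
    exact h1.prodMk ((((L.hasFDerivAt.comp _ (h1.sub_const p))).const_add ζ₀).add
      (h2.smul_const ℓ))
  let G : (ι → ℂ) × ℂ → ℂ := fun r => H (a r)
  have hG : AnalyticAt ℂ G (p, 0) := by
    refine AnalyticAt.comp ?_ ha
    rwa [ha0]
  have hG0 : G (p, 0) = 0 := by simp only [G, ha0, h0]
  have hGd : ∀ η μ, fderiv ℂ G (p, 0) (η, μ) = μ := by
    intro η μ
    have hHa : HasFDerivAt H (fderiv ℂ H (p, ζ₀)) (a (p, 0)) := by
      rw [ha0]; exact hH.differentiableAt.hasFDerivAt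
    have h1 : HasFDerivAt G _ (p, 0) := hHa.comp (p, (0 : ℂ)) had
    rw [h1.fderiv]
    simp only [ContinuousLinearMap.comp_apply, ContinuousLinearMap.prod_apply,
      ContinuousLinearMap.coe_fst', add_apply,
      ContinuousLinearMap.smulRight_apply, ContinuousLinearMap.coe_snd',
      fderiv_eq_gradPos_add_gradMom, ← hL]
    have h2 : gradMom H (p, ζ₀) ⬝ᵥ F.mulVec η = F.mulVec (gradMom H (p, ζ₀)) ⬝ᵥ η := by
      rw [Matrix.dotProduct_mulVec, ← Matrix.mulVec_transpose, hF.eq]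
    have h3 := congrArg (· ⬝ᵥ η) hcomp
    simp only [add_dotProduct, zero_dotProduct] at h3
    rw [dotProduct_add, dotProduct_smul, h2, dotProduct_comm _ ℓ, hℓ, smul_eq_mul, mul_one]
    linear_combination h3
  have cdf : ContDiffAt ℂ ω G (p, 0) := hG.contDiffAt
  have hid : fderiv ℂ G (p, 0) ∘L .inr ℂ (ι → ℂ) ℂ = .id ℂ ℂ := by
    ext
    simp [hGd]
  have hinv : (fderiv ℂ G (p, 0) ∘L .inr ℂ (ι → ℂ) ℂ).IsInvertible := by
    rw [hid]
    exact ⟨ContinuousLinearEquiv.refl ℂ _, rfl⟩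
  have hinl : fderiv ℂ G (p, 0) ∘L .inl ℂ (ι → ℂ) ℂ = 0 := by
    ext
    simp [hGd]
  refine ⟨cdf.implicitFunction (by simp) hinv,
    (cdf.contDiffAt_implicitFunction (by simp) hinv).analyticAt,
    cdf.implicitFunction_apply_self (by simp) hinv, ?_, ?_⟩
  · rw [(cdf.hasStrictFDerivAt_implicitFunction (by simp) hinv).hasFDerivAt.fderiv, hinl]
    simp
  · filter_upwards [cdf.eventually_apply_implicitFunction (by simp) hinv] with y hy
    rw [hG0] at hy
    exact hy

/-- The Cauchy problem for the Hamilton–Jacobi equation `H(z, ∂f) = 0` of a Hamiltonian satisfying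
Euler's identity, with prescribed second-order jet `(0, ζ₀, F)` at a noncharacteristic point.
The solution is obtained by the method of characteristics; since `∂f · ∂_ζ H = 0`, it is constant
along the characteristic curves. -/
theorem exists_hamiltonJacobi_solution {p ζ₀ ℓ : ι → ℂ} (hH : AnalyticAt ℂ H (p, ζ₀)) {m : ℂ}
    (heul : ∀ᶠ w in 𝓝 (p, ζ₀), w.2 ⬝ᵥ gradMom H w = m * H w)
    (h0 : H (p, ζ₀) = 0) (hℓ : ℓ ⬝ᵥ gradMom H (p, ζ₀) = 1) {F : Matrix ι ι ℂ} (hF : F.IsSymm)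
    (hcomp : gradPos H (p, ζ₀) + F.mulVec (gradMom H (p, ζ₀)) = 0) :
    ∃ (f : (ι → ℂ) → ℂ) (γ : (ι → ℂ) → ι → ℂ), AnalyticAt ℂ f p ∧ f p = 0 ∧
      AnalyticAt ℂ γ p ∧ γ p = ζ₀ ∧ (∀ h, fderiv ℂ γ p h = F.mulVec h) ∧
      ∀ᶠ z in 𝓝 p, (∀ h, fderiv ℂ f z h = γ z ⬝ᵥ h) ∧ H (z, γ z) = 0 := by
  obtain ⟨lam, hlam, hlam0, hlamd, hlamH⟩ := exists_null_momentum hH h0 hℓ hF hcomp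
  obtain ⟨Φ, hΦ, hΦ0, hΦt⟩ := hH.hamiltonField.exists_flow
  set v := gradMom H (p, ζ₀) with hv
  let L : (ι → ℂ) →L[ℂ] (ι → ℂ) := F.mulVecLin.toContinuousLinearMap
  have hL : ∀ v, F.mulVec v = L v := fun v => rfl
  let D : (ι → ℂ) →L[ℂ] ℂ := (dotProductBilin ℂ ℂ ℓ).toContinuousLinearMap
  -- The initial strip `(y, mom y)`.
  let mom : (ι → ℂ) → ι → ℂ := fun y => ζ₀ + L (y - p) + lam y • ℓ
  have hmom : AnalyticAt ℂ mom p :=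
    (analyticAt_const.add ((L.analyticAt _).comp (analyticAt_id.sub analyticAt_const))).add
      (hlam.smul analyticAt_const)
  have hmomp : mom p = ζ₀ := by simp [mom, hlam0]
  have hmomd : HasFDerivAt mom L p := by
    have h1 : HasFDerivAt lam (0 : (ι → ℂ) →L[ℂ] ℂ) p := by
      rw [← hlamd]; exact hlam.differentiableAt.hasFDerivAt
    have h2 := ((L.hasFDerivAt.comp p ((hasFDerivAt_id p).sub_const p)).const_add ζ₀).add
      (h1.smul_const ℓ)
    have h3 : HasFDerivAt mom _ p := h2
    refine h3.congr_fderiv ?_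
    ext; simp
  -- The bicharacteristics issuing from it.
  let Θ : ℂ × (ι → ℂ) → (ι → ℂ) × (ι → ℂ) := fun q => Φ (q.1, (q.2, mom q.2))
  let j : ℂ × (ι → ℂ) → ℂ × ((ι → ℂ) × (ι → ℂ)) := fun q => (q.1, (q.2, mom q.2))
  have hj0 : j (0, p) = (0, (p, ζ₀)) := by simp [j, hmomp]
  have hj : AnalyticAt ℂ j (0, p) :=
    analyticAt_fst.prod (analyticAt_snd.prod (AnalyticAt.comp (x := ((0 : ℂ), p)) hmom
      analyticAt_snd))
  have hjt : Tendsto j (𝓝 (0, p)) (𝓝 (0, (p, ζ₀))) := by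
    rw [← hj0]; exact hj.continuousAt.tendsto
  have hΘ : AnalyticAt ℂ Θ (0, p) := by
    refine AnalyticAt.comp (g := Φ) (f := j) ?_ hj
    rwa [hj0]
  have hsnd : Tendsto (fun q : ℂ × (ι → ℂ) => q.2) (𝓝 ((0 : ℂ), p)) (𝓝 p) :=
    continuous_snd.tendsto ((0 : ℂ), p)
  have hΘ0 : ∀ᶠ y in 𝓝 p, Θ (0, y) = (y, mom y) := by
    have : Tendsto (fun y => (y, mom y)) (𝓝 p) (𝓝 (p, ζ₀)) := by
      have := (continuousAt_id.prodMk hmom.continuousAt).tendsto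
      rwa [hmomp] at this
    exact this.eventually hΦ0
  have hΘp : Θ (0, p) = (p, ζ₀) := by rw [hΘ0.self_of_nhds, hmomp]
  have hΘt : ∀ᶠ q in 𝓝 ((0 : ℂ), p), fderiv ℂ Θ q (1, 0) = hamiltonField H (Θ q) := by
    filter_upwards [hjt.eventually hΦt, hjt.eventually hΦ.eventually_analyticAt,
      hsnd.eventually hmom.eventually_analyticAt] with q h1 h2 h3
    have e1 : HasFDerivAt (fun q : ℂ × (ι → ℂ) => mom q.2)
        ((fderiv ℂ mom q.2).comp (ContinuousLinearMap.snd ℂ ℂ (ι → ℂ))) q :=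
      h3.differentiableAt.hasFDerivAt.comp q hasFDerivAt_snd
    have e2 : HasFDerivAt Θ _ q := h2.differentiableAt.hasFDerivAt.comp q
      (hasFDerivAt_fst.prodMk (hasFDerivAt_snd.prodMk e1))
    rw [e2.fderiv]
    refine Eq.trans ?_ h1
    change fderiv ℂ Φ (j q) (1, (0, fderiv ℂ mom q.2 0)) = _
    rw [map_zero]
    rfl
  have hΘtend : Tendsto Θ (𝓝 (0, p)) (𝓝 (p, ζ₀)) := by
    rw [← hΘp]; exact hΘ.continuousAt.tendsto
  have hnull : ∀ᶠ q in 𝓝 ((0 : ℂ), p), H (Θ q) = 0 := by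
    have h1 : AnalyticAt ℂ (fun q => H (Θ q)) (0, p) := by
      refine AnalyticAt.comp ?_ hΘ
      rwa [hΘp]
    have h2 := h1.eventually_eq_initial (by
      filter_upwards [hΘt, hΘ.eventually_analyticAt, hΘtend.eventually hH.eventually_analyticAt]
        with q e1 e2 e3
      have e4 : HasFDerivAt (fun q => H (Θ q)) _ q :=
        e3.differentiableAt.hasFDerivAt.comp q e2.differentiableAt.hasFDerivAt
      rw [e4.fderiv, ContinuousLinearMap.comp_apply, e1, fderiv_apply_hamiltonField])
    filter_upwards [h2, hsnd.eventually hΘ0, hsnd.eventually hlamH] with q e1 e2 e3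
    rw [e1, e2]
    exact e3
  have hΘeul : ∀ᶠ q in 𝓝 ((0 : ℂ), p), (Θ q).2 ⬝ᵥ gradMom H (Θ q) = 0 := by
    filter_upwards [hnull, hΘtend.eventually heul] with q e1 e2
    rw [e2, e1, mul_zero]
  have hZ : AnalyticAt ℂ (fun q => (Θ q).1) (0, p) := analyticAt_fst.comp hΘ
  have hξ : AnalyticAt ℂ (fun q => (Θ q).2) (0, p) := analyticAt_snd.comp hΘ
  have hZd : ∀ q, AnalyticAt ℂ Θ q → ∀ u, fderiv ℂ (fun q => (Θ q).1) q u = (fderiv ℂ Θ q u).1 := by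
    intro q hq u
    rw [hq.differentiableAt.hasFDerivAt.fst.fderiv]; rfl
  have hξd : ∀ q, AnalyticAt ℂ Θ q → ∀ u, fderiv ℂ (fun q => (Θ q).2) q u = (fderiv ℂ Θ q u).2 := by
    intro q hq u
    rw [hq.differentiableAt.hasFDerivAt.snd.fderiv]; rfl
  have hZt : ∀ᶠ q in 𝓝 ((0 : ℂ), p),
      fderiv ℂ (fun q => (Θ q).1) q (1, 0) = gradMom H ((Θ q).1, (Θ q).2) := by
    filter_upwards [hΘt, hΘ.eventually_analyticAt] with q e1 e2
    rw [hZd q e2, e1]; rfl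
  have hξt : ∀ᶠ q in 𝓝 ((0 : ℂ), p),
      fderiv ℂ (fun q => (Θ q).2) q (1, 0) = -gradPos H ((Θ q).1, (Θ q).2) := by
    filter_upwards [hΘt, hΘ.eventually_analyticAt] with q e1 e2
    rw [hξd q e2, e1]; rfl
  have hcan := eventually_canonicalForm_eq_initial hZ hξ (by rw [hΘp]; exact hH) hZt hξt hnull hΘeul
  -- Spatial derivatives on the initial surface.
  have hinit : ∀ᶠ y in 𝓝 p, ∀ η, fderiv ℂ Θ (0, y) (0, η) = (η, fderiv ℂ mom y η) := by
    have ht : Tendsto (fun y => ((0 : ℂ), y)) (𝓝 p) (𝓝 (0, p)) :=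
      (Continuous.prodMk_right (0 : ℂ)).tendsto p
    filter_upwards [hΘ0.eventually_nhds, ht.eventually hΘ.eventually_analyticAt,
      hmom.eventually_analyticAt] with y e1 e2 e3 η
    have e4 : HasFDerivAt (fun y => Θ (0, y)) _ y :=
      e2.differentiableAt.hasFDerivAt.comp y (hasFDerivAt_prodMk_right (0 : ℂ) y)
    have e5 : (fun y => Θ (0, y)) =ᶠ[𝓝 y] fun y => (y, mom y) := e1
    have e6 := e4.unique (((hasFDerivAt_id y).prodMk
      e3.differentiableAt.hasFDerivAt).congr_of_eventuallyEq e5)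
    have e7 := DFunLike.congr_fun e6 η
    simpa using e7
  -- Split a point into a time and a point of the hyperplane `ℓ = 0` through `p`.
  let A : (ι → ℂ) →L[ℂ] ℂ × (ι → ℂ) := D.prod (.id ℂ _ - D.smulRight v)
  have hA : ∀ h, A h = (ℓ ⬝ᵥ h, h - (ℓ ⬝ᵥ h) • v) := fun h => rfl
  have hℓA : ∀ h, ℓ ⬝ᵥ (A h).2 = 0 := by
    intro h
    rw [hA, dotProduct_sub, dotProduct_smul, hℓ, smul_eq_mul, mul_one, sub_self]
  let W : (ι → ℂ) → ℂ × (ι → ℂ) := fun w => (0, p) + A (w - p)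
  have hW : ∀ w, AnalyticAt ℂ W w := fun w =>
    analyticAt_const.add ((A.analyticAt _).comp (analyticAt_id.sub analyticAt_const))
  have hWd : ∀ w, HasFDerivAt W A w := fun w =>
    (A.hasFDerivAt.comp w ((hasFDerivAt_id w).sub_const p)).const_add (0, p)
  have hWp : W p = (0, p) := by simp [W]
  have hWt : Tendsto W (𝓝 p) (𝓝 (0, p)) := by
    rw [← hWp]; exact (hW p).continuousAt.tendsto
  let Z : (ι → ℂ) → ι → ℂ := fun w => (Θ (W w)).1
  have hZan : AnalyticAt ℂ Z p := by
    refine AnalyticAt.comp (g := fun q => (Θ q).1) (f := W) ?_ (hW p)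
    rwa [hWp]
  have hZp : Z p = p := by simp [Z, hWp, hΘp]
  have hsplit : ∀ (T : ℂ × (ι → ℂ) →L[ℂ] ι → ℂ) (h : ι → ℂ),
      T (A h) = (ℓ ⬝ᵥ h) • T (1, 0) + T (0, (A h).2) := by
    intro T h
    rw [← map_smul, ← map_add]
    congr 1
    ext <;> simp [hA]
  have hZ'd : ∀ᶠ w in 𝓝 p, ∀ η, fderiv ℂ Z w η = (ℓ ⬝ᵥ η) • gradMom H (Θ (W w))
      + fderiv ℂ (fun q => (Θ q).1) (W w) (0, (A η).2) := by
    filter_upwards [hWt.eventually hZ.eventually_analyticAt, hWt.eventually hZt] with w e1 e2 η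
    have e3 : HasFDerivAt Z _ w := e1.differentiableAt.hasFDerivAt.comp w (hWd w)
    rw [e3.fderiv, ContinuousLinearMap.comp_apply, hsplit, e2]
  have hZder : fderiv ℂ Z p = .id ℂ _ := by
    ext1 η
    rw [hZ'd.self_of_nhds, hWp, hΘp, hZd _ hΘ, hinit.self_of_nhds, hA]
    simp [hv]
  have hZfd : HasFDerivAt Z ((ContinuousLinearEquiv.refl ℂ (ι → ℂ) : (ι → ℂ) →L[ℂ] ι → ℂ)) p := by
    have := hZan.differentiableAt.hasFDerivAt
    rw [hZder] at this
    exact this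
  have cdZ : ContDiffAt ℂ ω Z p := hZan.contDiffAt
  let R : (ι → ℂ) → ι → ℂ := cdZ.localInverse hZfd (by simp)
  have hR : AnalyticAt ℂ R p := by
    have := cdZ.to_localInverse hZfd (by simp)
    rw [hZp] at this
    exact this.analyticAt
  have hRp : R p = p := by
    have := cdZ.localInverse_apply_image hZfd (by simp)
    rwa [hZp] at this
  have hZR : ∀ᶠ z in 𝓝 p, Z (R z) = z := by
    have := (cdZ.hasStrictFDerivAt' hZfd (by simp)).eventually_right_inverse
    rwa [hZp] at this
  have hRt : Tendsto R (𝓝 p) (𝓝 p) := by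
    have := hR.continuousAt.tendsto
    rwa [hRp] at this
  have hZRd : ∀ᶠ z in 𝓝 p, ∀ h, fderiv ℂ Z (R z) (fderiv ℂ R z h) = h := by
    filter_upwards [hZR.eventually_nhds, hR.eventually_analyticAt,
      hRt.eventually hZan.eventually_analyticAt] with z e1 e2 e3 h
    have e4 : HasFDerivAt (fun z => Z (R z)) _ z :=
      e3.differentiableAt.hasFDerivAt.comp z e2.differentiableAt.hasFDerivAt
    have e5 : (fun z => Z (R z)) =ᶠ[𝓝 z] id := e1
    have e6 := e4.unique ((hasFDerivAt_id z).congr_of_eventuallyEq e5)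
    exact DFunLike.congr_fun e6 h
  -- The Cauchy datum, transported along the characteristic curves.
  let g : (ι → ℂ) → ℂ := fun y => ζ₀ ⬝ᵥ (y - p) + (1 / 2) * ((y - p) ⬝ᵥ L (y - p))
  have hidp : ∀ y, AnalyticAt ℂ (fun y : ι → ℂ => y - p) y := fun y =>
    analyticAt_id.sub analyticAt_const
  have hLp : ∀ y, AnalyticAt ℂ (fun y : ι → ℂ => L (y - p)) y := fun y =>
    (L.analyticAt _).comp (hidp y)
  have hg : ∀ y, AnalyticAt ℂ g y := fun y =>
    (analyticAt_const.dotProduct (hidp y)).add (analyticAt_const.mul ((hidp y).dotProduct (hLp y)))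
  have hgd : ∀ y η, fderiv ℂ g y η = (ζ₀ + L (y - p)) ⬝ᵥ η := by
    intro y η
    have e1 : fderiv ℂ (fun y : ι → ℂ => y - p) y = .id ℂ _ :=
      ((hasFDerivAt_id y).sub_const p).fderiv
    have e2 : fderiv ℂ (fun y : ι → ℂ => L (y - p)) y = L :=
      (L.hasFDerivAt.comp y ((hasFDerivAt_id y).sub_const p)).fderiv
    have a1 := (analyticAt_const (𝕜 := ℂ) (v := ζ₀) (x := y)).dotProduct (hidp y)
    have a2 := (hidp y).dotProduct (hLp y)
    have e3 : HasFDerivAt g _ y := a1.differentiableAt.hasFDerivAt.add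
      (a2.differentiableAt.hasFDerivAt.const_mul (1 / 2))
    rw [e3.fderiv, add_apply, smul_apply,
      fderiv_dotProduct_apply (analyticAt_const.differentiableAt) (hidp y).differentiableAt,
      fderiv_dotProduct_apply (hidp y).differentiableAt (hLp y).differentiableAt, e1, e2]
    have e4 : (y - p) ⬝ᵥ L η = L (y - p) ⬝ᵥ η := by
      rw [← hL, ← hL, Matrix.dotProduct_mulVec, ← Matrix.mulVec_transpose, hF.eq]
    simp only [ContinuousLinearMap.id_apply, e4, dotProduct_comm η, add_dotProduct,
      fderiv_fun_const, Pi.zero_apply, zero_apply, zero_dotProduct, smul_eq_mul]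
    ring
  let f : (ι → ℂ) → ℂ := fun z => g (W (R z)).2
  let γ : (ι → ℂ) → ι → ℂ := fun z => (Θ (W (R z))).2
  have hWR : AnalyticAt ℂ (fun z => W (R z)) p := AnalyticAt.comp (g := W) (hW _) hR
  have hf : AnalyticAt ℂ f p :=
    AnalyticAt.comp (g := g) (f := fun z => (W (R z)).2) (hg _) (analyticAt_snd.comp hWR)
  have hγ : AnalyticAt ℂ γ p := by
    refine AnalyticAt.comp (g := fun q => (Θ q).2) (f := fun z => W (R z)) ?_ hWR
    rwa [hRp, hWp]
  refine ⟨f, γ, hf, by simp [f, hRp, hWp, g], hγ, by simp [γ, hRp, hWp, hΘp], ?_, ?_⟩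
  · intro h
    have hRd : fderiv ℂ R p h = h := by
      have := hZRd.self_of_nhds h
      rwa [hRp, hZder] at this
    have hξ' : HasFDerivAt (fun q => (Θ q).2) (fderiv ℂ (fun q => (Θ q).2) (0, p)) (W (R p)) := by
      rw [hRp, hWp]; exact hξ.differentiableAt.hasFDerivAt
    have e1 : HasFDerivAt γ _ p :=
      HasFDerivAt.comp (g := fun q => (Θ q).2) (f := fun z => W (R z)) p hξ'
        ((hWd (R p)).comp p hR.differentiableAt.hasFDerivAt)
    rw [e1.fderiv]
    simp only [ContinuousLinearMap.comp_apply, hRd]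
    rw [hsplit, hξt.self_of_nhds, hξd _ hΘ, hinit.self_of_nhds,
      hmomd.fderiv, hΘp, ← eq_neg_of_add_eq_zero_right hcomp, hA, hL, hL]
    simp only [map_sub, map_smul]
    abel
  · filter_upwards [hZRd, hZR, hR.eventually_analyticAt, hRt.eventually hZ'd,
      hRt.eventually (hWt.eventually hcan), hRt.eventually (hWt.eventually hΘeul),
      hRt.eventually (hWt.eventually (hsnd.eventually hΘ0)),
      hRt.eventually (hWt.eventually (hsnd.eventually hinit)),
      hRt.eventually (hWt.eventually (hsnd.eventually
        (((Continuous.prodMk_right (0 : ℂ)).tendsto p).eventually hΘ.eventually_analyticAt))),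
      hRt.eventually (hWt.eventually hnull)] with z e1 e2 e3 e4 e5 e6 e7 e8 e9 e10
    refine ⟨fun h => ?_, ?_⟩
    · have hWRz : HasFDerivAt (fun z => (W (R z)).2) _ z :=
        ((hWd (R z)).comp z e3.differentiableAt.hasFDerivAt).snd
      have d1 : HasFDerivAt f _ z := (hg _).differentiableAt.hasFDerivAt.comp z hWRz
      rw [d1.fderiv]
      set k := fderiv ℂ R z h with hk
      have d2 : ((fderiv ℂ g (W (R z)).2).comp ((ContinuousLinearMap.snd ℂ ℂ (ι → ℂ)).comp
          (A.comp (fderiv ℂ R z)))) h = fderiv ℂ g (W (R z)).2 (A k).2 := rfl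
      refine d2.trans ?_
      rw [hgd, ← e1 h, ← hk, e4, dotProduct_add, dotProduct_smul]
      have d3 : γ z ⬝ᵥ gradMom H (Θ (W (R z))) = 0 := e6
      have d4 := e5 (A k).2
      rw [hZd _ e9, e8, e7] at d4
      rw [d3, smul_zero, zero_add]
      refine Eq.trans ?_ d4.symm
      simp only [mom]
      rw [add_dotProduct _ (lam _ • ℓ), smul_dotProduct, hℓA, smul_zero, add_zero]
    · have : (z, γ z) = Θ (W (R z)) := Prod.ext e2.symm rfl
      rw [this, e10]

end HamiltonJacobi

/-! ### The quadratic form completing a positive Hermitian form -/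

section Completion

/-- The bound `-|x|² ≤ Re (xᵀ U x)` for the symmetric unitary matrix `U` with rows
`(α / c, √d / c)` and `(√d / c, -ᾱ / c)`, at the vector `x = (√c l, √(c d) w)`. The difference of
the two sides, multiplied by `2 c`, is a sum of two squares. -/
theorem neg_le_re_unitary_quadratic {α l w : ℂ} {c d : ℝ} (hc : 0 < c) (hd : 0 < d)
    (hcd : c ^ 2 = d + Complex.normSq α) :
    -(c * Complex.normSq l + c * d * Complex.normSq w)
      ≤ (α * l ^ 2 + 2 * d * l * w - conj α * d * w ^ 2).re := by
  have h1 := Complex.normSq_nonneg (c * conj l + α * l + d * w)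
  have h2 := mul_nonneg hd.le (Complex.normSq_nonneg (c * conj w + l - conj α * w))
  have key : 2 * c * ((α * l ^ 2 + 2 * d * l * w - conj α * d * w ^ 2).re
      + (c * Complex.normSq l + c * d * Complex.normSq w))
      = Complex.normSq (c * conj l + α * l + d * w)
        + d * Complex.normSq (c * conj w + l - conj α * w) := by
    simp only [Complex.normSq_apply, pow_two, Complex.add_re, Complex.add_im, Complex.sub_re,
      Complex.sub_im, Complex.mul_re, Complex.mul_im, Complex.conj_re, Complex.conj_im,
      Complex.ofReal_re, Complex.ofReal_im, Complex.re_ofNat, Complex.im_ofNat] at hcd ⊢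
    linear_combination (l.re * l.re + l.im * l.im + d * (w.re * w.re + w.im * w.im)) * hcd
  have h3 : 0 ≤ 2 * c * ((α * l ^ 2 + 2 * d * l * w - conj α * d * w ^ 2).re
      + (c * Complex.normSq l + c * d * Complex.normSq w)) := by
    rw [key]; exact add_nonneg h1 h2
  have h4 := nonneg_of_mul_nonneg_right h3 (by positivity)
  linarith

variable {ι : Type*} [Fintype ι]

/-- The sesquilinear form `∑ Λ_{jk} s_j \bar t_k` of a matrix. -/
def sesqForm (Λ : Matrix ι ι ℂ) (s t : ι → ℂ) : ℂ := s ⬝ᵥ Λ.mulVec (star t)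

theorem sesqForm_eq_sum (Λ : Matrix ι ι ℂ) (s t : ι → ℂ) :
    sesqForm Λ s t = ∑ j, ∑ k, Λ j k * s j * conj (t k) := by
  simp only [sesqForm, dotProduct, Matrix.mulVec, Finset.mul_sum]
  refine Finset.sum_congr rfl fun j _ => Finset.sum_congr rfl fun k _ => ?_
  rw [Pi.star_apply, Complex.star_def]
  ring

theorem sesqForm_add_left (Λ : Matrix ι ι ℂ) (r s t : ι → ℂ) :
    sesqForm Λ (r + s) t = sesqForm Λ r t + sesqForm Λ s t := add_dotProduct _ _ _

theorem sesqForm_smul_left (Λ : Matrix ι ι ℂ) (a : ℂ) (s t : ι → ℂ) :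
    sesqForm Λ (a • s) t = a * sesqForm Λ s t := smul_dotProduct _ _ _

theorem sesqForm_swap {Λ : Matrix ι ι ℂ} (hΛ : Λ.IsHermitian) (s t : ι → ℂ) :
    sesqForm Λ t s = conj (sesqForm Λ s t) := by
  rw [← Complex.star_def, sesqForm, sesqForm, ← Matrix.star_dotProduct_star, Matrix.star_mulVec,
    hΛ.eq, star_star, Matrix.dotProduct_mulVec]

theorem sesqForm_add_smul_self {Λ : Matrix ι ι ℂ} (hΛ : Λ.IsHermitian) {s v : ι → ℂ}
    (hs : sesqForm Λ s v = 0) (a : ℂ) :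
    sesqForm Λ (s + a • v) (s + a • v) = sesqForm Λ s s + a * conj a * sesqForm Λ v v := by
  have h1 : sesqForm Λ v s = 0 := by rw [sesqForm_swap hΛ s v, hs, map_zero]
  rw [sesqForm_add_left, sesqForm_smul_left, sesqForm_swap hΛ _ s, sesqForm_swap hΛ _ v,
    sesqForm_add_left, sesqForm_smul_left, sesqForm_add_left, sesqForm_smul_left, hs, h1]
  simp only [map_add, map_mul, ← sesqForm_swap hΛ]
  simp
  ring

theorem sesqForm_self_im {Λ : Matrix ι ι ℂ} (hΛ : Λ.IsHermitian) (t : ι → ℂ) :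
    (sesqForm Λ t t).im = 0 :=
  Complex.conj_eq_iff_im.1 (sesqForm_swap hΛ t t).symm

/-- If the Hermitian form `|a|² Λ(v, v) + 2 Re (b(t) ā) + Λ(t, t)` is positive definite on `ℂ × T`,
where `v ∈ T`, then there is a symmetric bilinear form `M` with `M(v, ·) = b` which is
dominated by `Λ` on `T`.

Splitting `T` into `ℂ v` and its `Λ`-orthogonal complement, this completes a symmetric
`2 × 2` block matrix with prescribed first row to a strict contraction; the remaining entry is the
one that makes the block a multiple of a unitary matrix after rescaling the second coordinate. -/
theorem exists_symm_completion {Λ : Matrix ι ι ℂ} (hΛ : Λ.IsHermitian)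
    (T : Submodule ℂ (ι → ℂ)) {v : ι → ℂ} (hvT : v ∈ T) (hv : v ≠ 0) (b : ι → ℂ)
    (hpos : ∀ (a : ℂ), ∀ t ∈ T, (a ≠ 0 ∨ t ≠ 0) →
      0 < (a * conj a * sesqForm Λ v v + 2 * (b ⬝ᵥ t * conj a) + sesqForm Λ t t).re) :
    ∃ M : Matrix ι ι ℂ, M.IsSymm ∧ M.mulVec v = b ∧
      ∀ t ∈ T, t ≠ 0 → 0 < (t ⬝ᵥ M.mulVec t + sesqForm Λ t t).re := by
  set c : ℝ := (sesqForm Λ v v).re with hc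
  have hcv : sesqForm Λ v v = c := Complex.ext rfl (by simp [sesqForm_self_im hΛ])
  have hc0 : 0 < c := by
    have := hpos 1 0 T.zero_mem (Or.inl one_ne_zero)
    simpa [sesqForm, hc] using this
  have hcne : (c : ℂ) ≠ 0 := by exact_mod_cast hc0.ne'
  set α : ℂ := b ⬝ᵥ v with hα
  set d : ℝ := c ^ 2 - Complex.normSq α with hd
  have hd0 : 0 < d := by
    have h1 := hpos (-α / c) v hvT (Or.inr hv)
    rw [hcv, ← hα] at h1
    have h2 : -α / c * conj (-α / c) * c + 2 * (α * conj (-α / c)) + c = ((d / c : ℝ) : ℂ) := by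
      simp only [map_div₀, map_neg, Complex.conj_ofReal, hd]
      push_cast
      rw [Complex.normSq_eq_conj_mul_self]
      field_simp
      ring
    rw [h2, Complex.ofReal_re] at h1
    have h3 := mul_pos h1 hc0
    rwa [div_mul_cancel₀ _ hc0.ne'] at h3
  have hdne : (d : ℂ) ≠ 0 := by exact_mod_cast hd0.ne'
  have hcd : c ^ 2 = d + Complex.normSq α := by rw [hd]; ring
  -- `ℓ` is the component along `v`, and `d w` the part of `b` on the orthogonal complement.
  let ℓ : ι → ℂ := (c : ℂ)⁻¹ • Λ.mulVec (star v)
  have hℓ : ∀ t, ℓ ⬝ᵥ t = sesqForm Λ t v / c := by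
    intro t
    simp only [ℓ, smul_dotProduct, sesqForm, dotProduct_comm t, smul_eq_mul]
    ring
  have hℓv : ℓ ⬝ᵥ v = 1 := by rw [hℓ, hcv, div_self hcne]
  let w : ι → ℂ := (d : ℂ)⁻¹ • (b - α • ℓ)
  have hw : ∀ t, w ⬝ᵥ t = (b ⬝ᵥ t - α * (ℓ ⬝ᵥ t)) / d := by
    intro t
    simp only [w, smul_dotProduct, sub_dotProduct, smul_eq_mul]
    ring
  have hwv : w ⬝ᵥ v = 0 := by rw [hw, hℓv, ← hα]; simp
  let M : Matrix ι ι ℂ := α • Matrix.vecMulVec ℓ ℓ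
    + (d : ℂ) • (Matrix.vecMulVec ℓ w + Matrix.vecMulVec w ℓ)
    - (conj α * d) • Matrix.vecMulVec w w
  have hM : ∀ t, M.mulVec t = (α * (ℓ ⬝ᵥ t) + d * (w ⬝ᵥ t)) • ℓ
      + (d * (ℓ ⬝ᵥ t) - conj α * d * (w ⬝ᵥ t)) • w := by
    intro t
    ext i
    simp only [M, Matrix.sub_mulVec, Matrix.add_mulVec, Matrix.smul_mulVec,
      Matrix.vecMulVec_mulVec, Pi.add_apply, Pi.sub_apply, Pi.smul_apply, smul_eq_mul,
      MulOpposite.smul_eq_mul_unop, MulOpposite.unop_op]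
    ring
  refine ⟨M, ?_, ?_, ?_⟩
  · ext i k
    simp only [M, Matrix.transpose_apply, Matrix.sub_apply, Matrix.add_apply, Matrix.smul_apply,
      Matrix.vecMulVec_apply, smul_eq_mul]
    ring
  · rw [hM, hℓv, hwv]
    ext i
    simp only [w, Pi.add_apply, Pi.smul_apply, Pi.sub_apply, smul_eq_mul]
    field_simp
    ring
  · intro t ht ht0
    set l := ℓ ⬝ᵥ t with hl
    set u := w ⬝ᵥ t with hu
    set s := t - l • v with hs
    have hts : t = s + l • v := by rw [hs]; abel
    have hsT : s ∈ T := T.sub_mem ht (T.smul_mem _ hvT)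
    have hℓs : ℓ ⬝ᵥ s = 0 := by
      rw [hs, dotProduct_sub, dotProduct_smul, hℓv, ← hl]; simp
    have hsv : sesqForm Λ s v = 0 := by
      rw [hℓ, div_eq_zero_iff] at hℓs
      exact hℓs.resolve_right hcne
    have hbs : b ⬝ᵥ s = d * u := by
      have h1 : w ⬝ᵥ s = u := by rw [hs, dotProduct_sub, dotProduct_smul, hwv, ← hu]; simp
      rw [hw, hℓs] at h1
      rw [← h1]
      field_simp
      ring
    have hMt : t ⬝ᵥ M.mulVec t = α * l ^ 2 + 2 * d * l * u - conj α * d * u ^ 2 := by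
      rw [hM, dotProduct_comm, add_dotProduct, smul_dotProduct _ ℓ t, smul_dotProduct _ w t,
        ← hl, ← hu, smul_eq_mul, smul_eq_mul]
      ring
    have hΛt : (sesqForm Λ t t).re = (sesqForm Λ s s).re + c * Complex.normSq l := by
      rw [hts, sesqForm_add_smul_self hΛ hsv, hcv, Complex.mul_conj]
      simp [mul_comm]
    rw [Complex.add_re, hMt, hΛt]
    by_cases hs0 : s = 0
    · have hu0 : u = 0 := by
        have h1 := hbs
        rw [hs0, dotProduct_zero] at h1
        exact (mul_eq_zero.1 h1.symm).resolve_left hdne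
      have hl0 : l ≠ 0 := by
        rintro h
        apply ht0
        rw [hts, hs0, h]
        simp
      have h1 : ‖α‖ < c := by
        refine lt_of_pow_lt_pow_left₀ 2 hc0.le ?_
        rw [← Complex.normSq_eq_norm_sq]
        linarith
      have h2 : |(α * l ^ 2).re| ≤ ‖α‖ * Complex.normSq l := by
        refine (Complex.abs_re_le_norm _).trans_eq ?_
        rw [norm_mul, norm_pow, Complex.normSq_eq_norm_sq]
      have h3 : 0 < Complex.normSq l := Complex.normSq_pos.2 hl0
      have h4 := neg_le_of_abs_le h2
      have h5 := mul_lt_mul_of_pos_right h1 h3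
      have h6 : (sesqForm Λ s s).re = 0 := by rw [hs0]; simp [sesqForm]
      rw [hu0, h6]
      simp only [mul_zero, add_zero, ne_eq, OfNat.ofNat_ne_zero, not_false_eq_true, zero_pow,
        sub_zero]
      linarith
    · have h1 := neg_le_re_unitary_quadratic (l := l) (w := u) hc0 hd0 hcd
      -- The hypothesis at the vector of `ℂ × (s + ℂ v)` minimising the form.
      have hmin := hpos (-c * u) (s + (conj α * u) • v) (T.add_mem hsT (T.smul_mem _ hvT)) (by
        by_cases hu0 : u = 0
        · right; simpa [hu0] using hs0
        · left; exact mul_ne_zero (neg_ne_zero.2 hcne) hu0)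
      have h2 : -c * u * conj (-c * u) * sesqForm Λ v v
          + 2 * (b ⬝ᵥ (s + (conj α * u) • v) * conj (-c * u))
          + sesqForm Λ (s + (conj α * u) • v) (s + (conj α * u) • v)
          = sesqForm Λ s s - ((c * d * Complex.normSq u : ℝ) : ℂ) := by
        rw [sesqForm_add_smul_self hΛ hsv, hcv, dotProduct_add, dotProduct_smul, hbs, ← hα,
          smul_eq_mul]
        have h3 : (c : ℂ) ^ 2 = d + conj α * α := by
          rw [← Complex.normSq_eq_conj_mul_self]
          exact_mod_cast hcd
        simp only [map_mul, map_neg, Complex.conj_ofReal, Complex.conj_conj]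
        push_cast
        rw [Complex.normSq_eq_conj_mul_self]
        linear_combination (c * u * conj u) * h3
      rw [h2, Complex.sub_re, Complex.ofReal_re] at hmin
      linarith

end Completion

/-! ### Second-order expansions -/

section Taylor

variable {ι : Type*} [Fintype ι]

theorem norm_dotProduct_le_card_mul (a h : ι → ℂ) :
    ‖a ⬝ᵥ h‖ ≤ Fintype.card ι * (‖a‖ * ‖h‖) := by
  refine (norm_sum_le _ _).trans ?_
  rw [← nsmul_eq_mul, ← Finset.card_univ, ← Finset.sum_const]
  refine Finset.sum_le_sum fun i _ => ?_
  rw [norm_mul]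
  exact mul_le_mul (norm_le_pi_norm a i) (norm_le_pi_norm h i) (norm_nonneg _) (norm_nonneg _)

/-- Second-order expansion of a real function whose complex gradient `γ` vanishes at `p` and is
differentiable there. -/
theorem isLittleO_sub_re_dotProduct {ψ : (ι → ℂ) → ℝ} {γ : (ι → ℂ) → ι → ℂ} {p : ι → ℂ}
    {Γ : (ι → ℂ) →L[ℝ] (ι → ℂ)} (hψ : ∀ᶠ z in 𝓝 p, DifferentiableAt ℝ ψ z)
    (hψγ : ∀ᶠ z in 𝓝 p, ∀ h, fderiv ℝ ψ z h = 2 * (γ z ⬝ᵥ h).re)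
    (hγ0 : γ p = 0) (hγ : HasFDerivAt γ Γ p) :
    (fun z => ψ z - ψ p - (Γ (z - p) ⬝ᵥ (z - p)).re) =o[𝓝 p] fun z => ‖z - p‖ ^ 2 := by
  rw [Asymptotics.isLittleO_iff]
  intro ε hε
  set N : ℝ := ((Fintype.card ι : ℕ) : ℝ) with hN
  have hN0 : 0 ≤ N := Nat.cast_nonneg _
  have h1 := (Asymptotics.isLittleO_iff.1 hγ.isLittleO)
    (show 0 < ε / (2 * (N + 1)) by positivity)
  obtain ⟨δ, hδ, hball⟩ := Metric.eventually_nhds_iff_ball.1 (h1.and (hψ.and hψγ))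
  filter_upwards [Metric.ball_mem_nhds p hδ] with z hz
  set h := z - p with hh
  have hseg : ∀ t ∈ Set.Icc (0 : ℝ) 1, p + t • h ∈ Metric.ball p δ := by
    intro t ht
    rw [mem_ball_iff_norm, add_sub_cancel_left, norm_smul, Real.norm_of_nonneg ht.1]
    exact (mul_le_of_le_one_left (norm_nonneg _) ht.2).trans_lt (mem_ball_iff_norm.1 hz)
  have hder : ∀ t ∈ Set.Icc (0 : ℝ) 1, HasDerivWithinAt
      (fun t : ℝ => ψ (p + t • h) - t ^ 2 * (Γ h ⬝ᵥ h).re)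
      (2 * ((γ (p + t • h) - γ p - Γ (p + t • h - p)) ⬝ᵥ h).re) (Set.Icc 0 1) t := by
    intro t ht
    obtain ⟨-, hd, hg⟩ := hball _ (hseg t ht)
    have e1 : HasDerivAt (fun t : ℝ => p + t • h) h t := by
      simpa using ((hasDerivAt_id t).smul_const h).const_add p
    have e2 := hd.hasFDerivAt.comp_hasDerivAt t e1
    have e3 := (e2.sub ((hasDerivAt_pow 2 t).mul_const (Γ h ⬝ᵥ h).re)).hasDerivWithinAt
      (s := Set.Icc 0 1)
    refine e3.congr_deriv ?_
    rw [hg, hγ0, sub_zero, add_sub_cancel_left, map_smul, sub_dotProduct, smul_dotProduct,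
      Complex.sub_re, Complex.smul_re, smul_eq_mul]
    push_cast
    ring
  have hbound : ∀ t ∈ Set.Ico (0 : ℝ) 1,
      ‖2 * ((γ (p + t • h) - γ p - Γ (p + t • h - p)) ⬝ᵥ h).re‖ ≤ ε * ‖h‖ ^ 2 := by
    intro t ht
    obtain ⟨hb, -, -⟩ := hball _ (hseg t ⟨ht.1, ht.2.le⟩)
    rw [add_sub_cancel_left, norm_smul, Real.norm_of_nonneg ht.1] at hb
    rw [add_sub_cancel_left, norm_mul, Real.norm_of_nonneg (zero_le_two (α := ℝ))]
    have e1 := (Complex.abs_re_le_norm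
      ((γ (p + t • h) - γ p - Γ (t • h)) ⬝ᵥ h)).trans (norm_dotProduct_le_card_mul _ _)
    rw [← Real.norm_eq_abs] at e1
    have e2 : ‖γ (p + t • h) - γ p - Γ (t • h)‖ ≤ ε / (2 * (N + 1)) * ‖h‖ := by
      refine hb.trans ?_
      gcongr
      exact mul_le_of_le_one_left (norm_nonneg _) ht.2.le
    calc _ ≤ 2 * (N * (‖γ (p + t • h) - γ p - Γ (t • h)‖ * ‖h‖)) := by gcongr
      _ ≤ 2 * ((N + 1) * (ε / (2 * (N + 1)) * ‖h‖ * ‖h‖)) := by gcongr; linarith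
      _ = ε * ‖h‖ ^ 2 := by field_simp
  have := norm_image_sub_le_of_norm_deriv_le_segment_01' hder hbound
  simp only [one_smul, zero_smul, add_zero, one_pow, one_mul, ne_eq, OfNat.ofNat_ne_zero,
    not_false_eq_true, zero_pow, zero_mul, sub_zero] at this
  rw [hh, add_sub_cancel, ← hh] at this
  rw [Real.norm_of_nonneg (by positivity : 0 ≤ ‖h‖ ^ 2)]
  convert! this using 2
  ring

/-- If the second-order part `q` of `ψ` is positive on the nonzero tangent vectors of `{f = 0}`,
then `ψ` is positive on `{f = 0}` near `p`, except at `p`. -/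
theorem eventually_pos_on_zero_set {E F : Type*} [NormedAddCommGroup E] [NormedSpace ℝ E]
    [FiniteDimensional ℝ E] [NormedAddCommGroup F] [NormedSpace ℝ F] {ψ q : E → ℝ} {f : E → F}
    {p : E} {f' : E →L[ℝ] F} (hf : HasFDerivAt f f' p) (hf0 : f p = 0) (hq : Continuous q)
    (hq2 : ∀ (c : ℝ) h, q (c • h) = c ^ 2 * q h)
    (hψ : (fun z => ψ z - q (z - p)) =o[𝓝 p] fun z => ‖z - p‖ ^ 2)
    (hpos : ∀ h, h ≠ 0 → f' h = 0 → 0 < q h) :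
    ∀ᶠ z in 𝓝[≠] p, f z = 0 → 0 < ψ z := by
  by_contra hcon
  -- Otherwise the directions of points `z` with `f z = 0` and `ψ z ≤ 0` accumulate at some `t`.
  set l : Filter E := 𝓝[≠] p ⊓ 𝓟 {z | f z = 0 ∧ ψ z ≤ 0} with hl
  have hne : l.NeBot := by
    rw [hl, ← frequently_iff_neBot]
    refine (not_eventually.1 hcon).mono fun z hz => ?_
    push Not at hz
    exact hz
  set u : E → E := fun z => ‖z - p‖⁻¹ • (z - p) with hu
  set 𝒰 : Ultrafilter E := Ultrafilter.of l
  have h𝒰 : (𝒰 : Filter E) ≤ l := Ultrafilter.of_le l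
  have hlp : l ≤ 𝓝 p := inf_le_left.trans nhdsWithin_le_nhds
  have hlne : ∀ᶠ z in l, z ≠ p := (inf_le_left : l ≤ 𝓝[≠] p) self_mem_nhdsWithin
  have hlbad : ∀ᶠ z in l, f z = 0 ∧ ψ z ≤ 0 := (inf_le_right : l ≤ 𝓟 _) (mem_principal_self _)
  have hsph : ∀ᶠ z in l, u z ∈ Metric.sphere (0 : E) 1 := by
    filter_upwards [hlne] with z hz
    have : ‖z - p‖ ≠ 0 := norm_ne_zero_iff.2 (sub_ne_zero.2 hz)
    rw [mem_sphere_zero_iff_norm, hu, norm_smul, norm_inv, norm_norm, inv_mul_cancel₀ this]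
  obtain ⟨t, ht, htu⟩ := isCompact_iff_ultrafilter_le_nhds.1 (isCompact_sphere (0 : E) 1)
    (𝒰.map u) (by rw [le_principal_iff]; exact h𝒰 hsph)
  have htend : Tendsto u 𝒰 (𝓝 t) := htu
  have ht0 : t ≠ 0 := by
    rintro rfl
    simp at ht
  have hft : f' t = 0 := by
    have h1 : ∀ ε > 0, ∀ᶠ z in (𝒰 : Filter E), ‖f' (u z)‖ ≤ ε := by
      intro ε hε
      have := Asymptotics.isLittleO_iff.1 hf.isLittleO hε
      filter_upwards [h𝒰 (hlp this), h𝒰 hlne, h𝒰 hlbad] with z e1 e2 e3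
      have hz : 0 < ‖z - p‖ := norm_pos_iff.2 (sub_ne_zero.2 e2)
      rw [e3.1, hf0, sub_zero, zero_sub, norm_neg] at e1
      rw [hu, map_smul, norm_smul, norm_inv, norm_norm, inv_mul_le_iff₀ hz]
      linarith
    have h2 : Tendsto (fun z => ‖f' (u z)‖) 𝒰 (𝓝 ‖f' t‖) :=
      (f'.continuous.norm.tendsto t).comp htend
    have h3 : ‖f' t‖ ≤ 0 := le_of_forall_pos_le_add fun ε hε => by
      rw [zero_add]; exact le_of_tendsto h2 (h1 ε hε)
    exact norm_le_zero_iff.1 h3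
  have hqt : q t ≤ 0 := by
    have h1 : ∀ ε > 0, ∀ᶠ z in (𝒰 : Filter E), q (u z) ≤ ε := by
      intro ε hε
      have := Asymptotics.isLittleO_iff.1 hψ hε
      filter_upwards [h𝒰 (hlp this), h𝒰 hlne, h𝒰 hlbad] with z e1 e2 e3
      have hz : 0 < ‖z - p‖ := norm_pos_iff.2 (sub_ne_zero.2 e2)
      rw [Real.norm_of_nonneg (by positivity : 0 ≤ ‖z - p‖ ^ 2)] at e1
      have e4 := neg_le_of_abs_le e1
      rw [hu, hq2, inv_pow, inv_mul_le_iff₀ (by positivity)]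
      linarith [e3.2]
    have h2 : Tendsto (fun z => q (u z)) 𝒰 (𝓝 (q t)) := (hq.tendsto t).comp htend
    exact le_of_forall_pos_le_add fun ε hε => by
      rw [zero_add]; exact le_of_tendsto h2 (h1 ε hε)
  exact absurd (hpos t ht0 hft) (not_lt.2 hqt)

end Taylor

/-! ### Wirtinger calculus -/

section Wirtinger

variable {n : ℕ}

theorem fderiv_eq_wirtinger (φ : CSpace n → ℂ) (z h : CSpace n) :
    fderiv ℝ φ z h
      = ∑ j, wirtinger j φ z * h j + ∑ j, wirtingerBar j φ z * conj (h j) := by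
  have hh : h = ∑ j, ((h j).re • (Pi.single j 1 : CSpace n)
      + (h j).im • (Pi.single j Complex.I : CSpace n)) := by
    conv_lhs => rw [pi_eq_sum_univ' h]
    refine Finset.sum_congr rfl fun j _ => ?_
    ext i
    rcases eq_or_ne i j with rfl | hij
    · simp
    · simp [hij]
  conv_lhs => rw [hh]
  rw [map_sum, ← Finset.sum_add_distrib]
  refine Finset.sum_congr rfl fun j _ => ?_
  rw [map_add, map_smul, map_smul, Complex.real_smul, Complex.real_smul]
  apply Complex.ext <;> simp [wirtinger, wirtingerBar] <;> ring

/-- For a holomorphic function the Wirtinger derivatives are the complex partial derivatives. -/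
theorem wirtinger_eq_of_differentiableAt {f : CSpace n → ℂ} {z : CSpace n}
    (hf : DifferentiableAt ℂ f z) (j : Fin (n + 1)) :
    wirtinger j f z = fderiv ℂ f z (Pi.single j 1) := by
  have h1 : (Pi.single j Complex.I : CSpace n) = Complex.I • Pi.single j 1 := by
    rw [← Pi.single_smul, smul_eq_mul, mul_one]
  rw [wirtinger, hf.fderiv_restrictScalars ℝ]
  simp only [ContinuousLinearMap.coe_restrictScalars', h1, map_smul, smul_eq_mul]
  linear_combination (-(fderiv ℂ f z (Pi.single j 1)) / 2) * Complex.I_mul_I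

theorem fderiv_toComplexFun {ρ : CSpace n → ℝ} {z : CSpace n} (hρ : DifferentiableAt ℝ ρ z)
    (h : CSpace n) : fderiv ℝ (toComplexFun ρ) z h = (fderiv ℝ ρ z h : ℂ) := by
  have : HasFDerivAt (toComplexFun ρ) (Complex.ofRealCLM.comp (fderiv ℝ ρ z)) z :=
    Complex.ofRealCLM.hasFDerivAt.comp z hρ.hasFDerivAt
  rw [this.fderiv]
  rfl

theorem fderiv_eq_two_mul_re_holGrad {ρ : CSpace n → ℝ} {z : CSpace n}
    (hρ : DifferentiableAt ℝ ρ z) (h : CSpace n) :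
    fderiv ℝ ρ z h = 2 * (holGrad (toComplexFun ρ) z ⬝ᵥ h).re := by
  have hbar : ∀ j, wirtingerBar j (toComplexFun ρ) z = conj (wirtinger j (toComplexFun ρ) z) := by
    intro j
    simp only [wirtinger, wirtingerBar, fderiv_toComplexFun hρ, map_div₀, map_sub, map_mul,
      Complex.conj_ofReal, Complex.conj_I, Complex.conj_ofNat]
    ring
  have h1 := fderiv_eq_wirtinger (toComplexFun ρ) z h
  rw [fderiv_toComplexFun hρ] at h1
  simp only [hbar, ← map_mul, ← map_sum] at h1
  rw [Complex.add_conj] at h1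
  exact_mod_cast h1

variable {ρ : CSpace n → ℝ} {p : CSpace n}

theorem differentiableAt_holGrad (hρ : ContDiffAt ℝ (⊤ : ℕ∞) ρ p) :
    DifferentiableAt ℝ (holGrad (toComplexFun ρ)) p := by
  have h1 : ContDiffAt ℝ (⊤ : ℕ∞) (toComplexFun ρ) p :=
    Complex.ofRealCLM.contDiff.contDiffAt.comp p hρ
  have h2 : DifferentiableAt ℝ (fderiv ℝ (toComplexFun ρ)) p :=
    (h1.fderiv_right (m := 1) (by norm_cast)).differentiableAt (by simp)
  refine differentiableAt_pi.2 fun j => ?_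
  have h3 : ∀ v, DifferentiableAt ℝ (fun z => fderiv ℝ (toComplexFun ρ) z v) p :=
    fun v => h2.clm_apply (differentiableAt_const v)
  exact ((h3 _).fun_sub ((h3 _).const_mul Complex.I)).mul_const (2⁻¹ : ℂ)

/-- The matrix of second derivatives `ρ_{z_j z_k}`. -/
def hessMatrix (ρ : CSpace n → ℝ) (p : CSpace n) : Matrix (Fin (n + 1)) (Fin (n + 1)) ℂ :=
  Matrix.of (holHessCoeff ρ p)

/-- The matrix `ρ_{z_j z̄_k}` of the Levi form. -/
def leviMatrix (ρ : CSpace n → ℝ) (p : CSpace n) : Matrix (Fin (n + 1)) (Fin (n + 1)) ℂ :=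
  Matrix.of (leviCoeff ρ p)

/-- The differential of the holomorphic gradient of a real function, in terms of the second
derivatives `ρ_{z_j z_k}` and `ρ_{z_j z̄_k}`. -/
theorem fderiv_holGrad (hρ : ContDiffAt ℝ (⊤ : ℕ∞) ρ p) (h : CSpace n) :
    fderiv ℝ (holGrad (toComplexFun ρ)) p h
      = (hessMatrix ρ p).mulVec h + (leviMatrix ρ p).mulVec (star h) := by
  ext j
  have h1 := hasFDerivAt_pi'.1 (differentiableAt_holGrad hρ).hasFDerivAt j
  have h2 := DFunLike.congr_fun h1.fderiv h
  have h3 := fderiv_eq_wirtinger (wirtinger j (toComplexFun ρ)) p h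
  exact h2.symm.trans h3

/-- Symmetry of the second real derivative of `ρ`, in terms of its holomorphic gradient. -/
theorem re_fderiv_holGrad_symm (hρ : ContDiffAt ℝ (⊤ : ℕ∞) ρ p) (h k : CSpace n) :
    (fderiv ℝ (holGrad (toComplexFun ρ)) p k ⬝ᵥ h).re
      = (fderiv ℝ (holGrad (toComplexFun ρ)) p h ⬝ᵥ k).re := by
  have h1 : ∀ᶠ z in 𝓝 p, DifferentiableAt ℝ ρ z := by
    have := (hρ.of_le (m := 1) (by norm_cast)).eventually (by simp)
    exact this.mono fun z hz => hz.differentiableAt (by simp)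
  have hd2 : DifferentiableAt ℝ (fderiv ℝ ρ) p :=
    (hρ.fderiv_right (m := 1) (by norm_cast)).differentiableAt (by simp)
  have key : ∀ h k, fderiv ℝ (fderiv ℝ ρ) p k h
      = 2 * (fderiv ℝ (holGrad (toComplexFun ρ)) p k ⬝ᵥ h).re := by
    intro h k
    have e1 : HasFDerivAt (fun z => fderiv ℝ ρ z h) _ p :=
      (ContinuousLinearMap.apply ℝ ℝ h).hasFDerivAt.comp p hd2.hasFDerivAt
    let B : CSpace n →L[ℝ] ℝ := Complex.reCLM.comp
      (((dotProductBilin ℂ ℂ h).toContinuousLinearMap).restrictScalars ℝ)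
    have e2 : HasFDerivAt (fun z => 2 * B (holGrad (toComplexFun ρ) z)) _ p :=
      (B.hasFDerivAt.comp p (differentiableAt_holGrad hρ).hasFDerivAt).const_mul 2
    have e3 : (fun z => fderiv ℝ ρ z h) =ᶠ[𝓝 p] fun z => 2 * B (holGrad (toComplexFun ρ) z) := by
      filter_upwards [h1] with z hz
      rw [fderiv_eq_two_mul_re_holGrad hz, dotProduct_comm]
      rfl
    have e4 := DFunLike.congr_fun (e1.unique (e2.congr_of_eventuallyEq e3)) k
    rw [dotProduct_comm]
    exact e4
  have hsymm : IsSymmSndFDerivAt ℝ ρ p :=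
    hρ.isSymmSndFDerivAt (by simp [minSmoothness_of_isRCLikeNormedField]; norm_cast)
  have := hsymm.eq k h
  rw [key, key] at this
  linarith

theorem isSymm_and_isHermitian_hess (hρ : ContDiffAt ℝ (⊤ : ℕ∞) ρ p) :
    (hessMatrix ρ p).IsSymm ∧ (leviMatrix ρ p).IsHermitian := by
  -- Testing the symmetry on vectors with the single entries `1` or `I` separates the two matrices.
  have key : ∀ (a b : Fin (n + 1)) (x y : ℂ),
      ((holHessCoeff ρ p b a * x + leviCoeff ρ p b a * conj x) * y).re
        = ((holHessCoeff ρ p a b * y + leviCoeff ρ p a b * conj y) * x).re := by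
    intro a b x y
    have := re_fderiv_holGrad_symm hρ (Pi.single b y) (Pi.single a x)
    have hstar : ∀ (a : Fin (n + 1)) (x : ℂ),
        star (Pi.single a x : CSpace n) = Pi.single a (conj x) := by
      intro a x
      ext i
      rcases eq_or_ne i a with rfl | h
      · simp
      · simp [h]
    rw [fderiv_holGrad hρ, fderiv_holGrad hρ, hstar, hstar] at this
    have hmul : ∀ (M : Matrix (Fin (n + 1)) (Fin (n + 1)) ℂ) (a b : Fin (n + 1)) (x : ℂ),
        M.mulVec (Pi.single a x) b = M b a * x := fun M a b x => dotProduct_single _ _ _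
    rw [dotProduct_single, dotProduct_single, Pi.add_apply, Pi.add_apply,
      hmul (hessMatrix ρ p) a b, hmul (leviMatrix ρ p) a b, hmul (hessMatrix ρ p) b a,
      hmul (leviMatrix ρ p) b a] at this
    exact this
  have hre : ∀ a b, (holHessCoeff ρ p b a).re = (holHessCoeff ρ p a b).re ∧
      (holHessCoeff ρ p b a).im = (holHessCoeff ρ p a b).im ∧
      (leviCoeff ρ p b a).re = (leviCoeff ρ p a b).re ∧
      -(leviCoeff ρ p b a).im = (leviCoeff ρ p a b).im := by
    intro a b
    have e1 := key a b 1 1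
    have e2 := key a b Complex.I Complex.I
    have e3 := key a b 1 Complex.I
    have e4 := key a b Complex.I 1
    simp only [map_one, mul_one, Complex.add_re, Complex.conj_I, Complex.mul_re, Complex.add_im,
      Complex.mul_im, Complex.I_re, Complex.I_im, Complex.neg_re, Complex.neg_im] at e1 e2 e3 e4
    refine ⟨?_, ?_, ?_, ?_⟩ <;> linarith
  constructor
  · ext a b
    exact Complex.ext (hre a b).1 (hre a b).2.1
  · ext a b
    exact Complex.ext (hre a b).2.2.1 (hre a b).2.2.2

end Wirtinger

/-! ### The principal symbol -/

section Symbol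

variable {n : ℕ} {V : Set (CSpace n)} (P : HolomorphicPDO n V)

theorem analyticAt_symbol {z : CSpace n} (hz : z ∈ V) (ζ : CSpace n) :
    AnalyticAt ℂ (fun w : CSpace n × CSpace n => P.symbol w.1 w.2) (z, ζ) := by
  refine Finset.analyticAt_fun_sum _ fun α hα => ?_
  have hα' : ∑ i, α i ≤ P.order := (Finset.mem_piAntidiag.1 hα).1.le
  refine AnalyticAt.mul ?_ (Finset.analyticAt_fun_prod _ fun i _ => AnalyticAt.pow ?_ _)
  · exact AnalyticAt.comp (x := (z, ζ)) (P.holomorphic_coeff α hα' z hz) analyticAt_fst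
  · exact ((ContinuousLinearMap.proj (R := ℂ) (φ := fun _ : Fin (n + 1) => ℂ) i).comp
      (ContinuousLinearMap.snd ℂ (CSpace n) (CSpace n))).analyticAt _

theorem symbol_smul (z ζ : CSpace n) (c : ℂ) :
    P.symbol z (c • ζ) = c ^ P.order * P.symbol z ζ := by
  rw [HolomorphicPDO.symbol, HolomorphicPDO.symbol, Finset.mul_sum]
  refine Finset.sum_congr rfl fun α hα => ?_
  have hα' : ∑ i, α i = P.order := (Finset.mem_piAntidiag.1 hα).1
  simp only [Pi.smul_apply, smul_eq_mul, mul_pow, Finset.prod_mul_distrib]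
  rw [Finset.prod_pow_eq_pow_sum, hα']
  ring

theorem symbolDz_eq_gradPos {z : CSpace n} (hz : z ∈ V) (ζ : CSpace n) (j : Fin (n + 1)) :
    P.symbolDz j z ζ = gradPos (fun w => P.symbol w.1 w.2) (z, ζ) j := by
  have h : HasFDerivAt (fun w => P.symbol w ζ) _ z :=
    HasFDerivAt.comp (g := fun w : CSpace n × CSpace n => P.symbol w.1 w.2)
      (f := fun w => (w, ζ)) z (analyticAt_symbol P hz ζ).differentiableAt.hasFDerivAt
      (hasFDerivAt_prodMk_left z ζ)
  rw [HolomorphicPDO.symbolDz, complexPartial, h.fderiv]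
  rfl

theorem symbolDzeta_eq_gradMom {z : CSpace n} (hz : z ∈ V) (ζ : CSpace n) (j : Fin (n + 1)) :
    P.symbolDzeta j z ζ = gradMom (fun w => P.symbol w.1 w.2) (z, ζ) j := by
  have h : HasFDerivAt (fun ξ => P.symbol z ξ) _ ζ :=
    HasFDerivAt.comp (g := fun w : CSpace n × CSpace n => P.symbol w.1 w.2)
      (f := fun ξ => (z, ξ)) ζ (analyticAt_symbol P hz ζ).differentiableAt.hasFDerivAt
      (hasFDerivAt_prodMk_right z ζ)
  rw [HolomorphicPDO.symbolDzeta, complexPartial, h.fderiv]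
  rfl

/-- Euler's identity for the principal symbol. -/
theorem dotProduct_gradMom_symbol {z : CSpace n} (hz : z ∈ V) (ζ : CSpace n) :
    ζ ⬝ᵥ gradMom (fun w => P.symbol w.1 w.2) (z, ζ) = P.order * P.symbol z ζ := by
  have h1 : HasDerivAt (fun c : ℂ => (z, c • ζ)) ((0 : CSpace n), ζ) 1 := by
    have := (hasDerivAt_id (1 : ℂ)).smul_const ζ
    simp only [one_smul] at this
    exact (hasDerivAt_const _ _).prodMk this
  have h2 : HasFDerivAt (fun w : CSpace n × CSpace n => P.symbol w.1 w.2)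
      (fderiv ℂ (fun w : CSpace n × CSpace n => P.symbol w.1 w.2) (z, ζ)) (z, (1 : ℂ) • ζ) := by
    rw [one_smul]
    exact (analyticAt_symbol P hz ζ).differentiableAt.hasFDerivAt
  have h3 := h2.comp_hasDerivAt (1 : ℂ) h1
  have h4 : HasDerivAt (fun c : ℂ => c ^ P.order * P.symbol z ζ)
      (P.order * 1 ^ (P.order - 1) * P.symbol z ζ) 1 := (hasDerivAt_pow _ _).mul_const _
  have h5 := h3.unique (h4.congr_of_eventuallyEq (Eventually.of_forall fun c => symbol_smul P z ζ c))
  rw [fderiv_eq_gradPos_add_gradMom, dotProduct_zero, zero_add, one_pow, mul_one,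
    dotProduct_comm] at h5
  exact h5

/-- The Kashiwara–Kawai form in the shape `|a|² Λ(v, v) + 2 Re (b(t) ā) + Λ(t, t)`, with
`v` the gradient of the symbol in `ζ` and `b` the vector of entries `q_{j,0}`. -/
theorem kkForm_cons (ρ : CSpace n → ℝ) (p : CSpace n) (a : ℂ) (t : CSpace n) :
    (kkForm P ρ p (Fin.cons a t)).re
      = (a * conj a * sesqForm (leviMatrix ρ p)
          (fun j => P.symbolDzeta j p (holGrad (toComplexFun ρ) p))
          (fun j => P.symbolDzeta j p (holGrad (toComplexFun ρ) p))
        + 2 * (kkMixed P ρ p ⬝ᵥ t * conj a) + sesqForm (leviMatrix ρ p) t t).re := by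
  have h1 : kkForm P ρ p (Fin.cons a t) = a * conj a * kkCorner P ρ p
      + (kkMixed P ρ p ⬝ᵥ t * conj a + conj (kkMixed P ρ p ⬝ᵥ t * conj a))
      + sesqForm (leviMatrix ρ p) t t := by
    rw [sesqForm_eq_sum, kkForm]
    simp only [leviMatrix, Matrix.of_apply, kkCoeff, Fin.sum_univ_succ (n := n + 1),
      Fin.cons_zero, Fin.cons_succ, Finset.sum_add_distrib, dotProduct, Finset.sum_mul, map_sum, map_mul, Complex.conj_conj]
    have h2 : ∀ x y : CSpace n, ∑ i, x i * a * y i = ∑ i, x i * y i * a :=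
      fun x y => Finset.sum_congr rfl fun i _ => by ring
    rw [h2 (fun i => conj (kkMixed P ρ p i)) fun i => conj (t i)]
    ring
  have h3 : kkCorner P ρ p = sesqForm (leviMatrix ρ p)
      (fun j => P.symbolDzeta j p (holGrad (toComplexFun ρ) p))
      (fun j => P.symbolDzeta j p (holGrad (toComplexFun ρ) p)) := by
    rw [sesqForm_eq_sum, kkCorner]
    exact Finset.sum_congr rfl fun j _ => Finset.sum_congr rfl fun k _ => by
      simp only [leviMatrix, Matrix.of_apply]
      ring
  rw [h1, Complex.add_conj, h3]
  simp

end Symbol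

/-! ### Strong `P`-convexity -/

/-- A holomorphic function whose second-order jet at `p` makes `ρ - 2 Re f` positive to second
order on the holomorphic tangent space has a zero set that touches `{ρ ≤ 0}` only at `p`. -/
theorem eventually_pos_of_jet {n : ℕ} {ρ : CSpace n → ℝ} {p : CSpace n}
    (hρ : ContDiffAt ℝ (⊤ : ℕ∞) ρ p) (hρp : ρ p = 0) {f : CSpace n → ℂ} {γ : CSpace n → CSpace n}
    {M : Matrix (Fin (n + 1)) (Fin (n + 1)) ℂ} (hf : AnalyticAt ℂ f p) (hfp : f p = 0)
    (hγ : AnalyticAt ℂ γ p) (hγp : γ p = holGrad (toComplexFun ρ) p)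
    (hγd : ∀ h, fderiv ℂ γ p h = (hessMatrix ρ p).mulVec h - M.mulVec h)
    (hfγ : ∀ᶠ z in 𝓝 p, ∀ h, fderiv ℂ f z h = γ z ⬝ᵥ h)
    (hpos : ∀ t, holGrad (toComplexFun ρ) p ⬝ᵥ t = 0 → t ≠ 0 →
      0 < (t ⬝ᵥ M.mulVec t + sesqForm (leviMatrix ρ p) t t).re) :
    ∀ᶠ z in 𝓝[≠] p, f z = 0 → 0 < ρ z := by
  let Γ : CSpace n →L[ℝ] CSpace n :=
    fderiv ℝ (holGrad (toComplexFun ρ)) p - (fderiv ℂ γ p).restrictScalars ℝ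
  have hΓ : ∀ h, (Γ h ⬝ᵥ h) = h ⬝ᵥ M.mulVec h + sesqForm (leviMatrix ρ p) h h := by
    intro h
    have : Γ h = M.mulVec h + (leviMatrix ρ p).mulVec (star h) := by
      simp only [Γ, sub_apply, ContinuousLinearMap.coe_restrictScalars',
        fderiv_holGrad hρ, hγd]
      abel
    rw [this, add_dotProduct, dotProduct_comm, sesqForm, dotProduct_comm h ((leviMatrix ρ p).mulVec _)]
  have hρd : ∀ᶠ z in 𝓝 p, DifferentiableAt ℝ ρ z := by
    have := (hρ.of_le (m := 1) (by norm_cast)).eventually (by simp)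
    exact this.mono fun z hz => hz.differentiableAt (by simp)
  have hfd : ∀ᶠ z in 𝓝 p, HasFDerivAt (fun z => (f z).re)
      (Complex.reCLM.comp ((fderiv ℂ f z).restrictScalars ℝ)) z :=
    hf.eventually_analyticAt.mono fun z hz =>
      Complex.reCLM.hasFDerivAt.comp z (hz.differentiableAt.hasFDerivAt.restrictScalars ℝ)
  have hψ := isLittleO_sub_re_dotProduct (ψ := fun z => ρ z - 2 * (f z).re)
    (γ := fun z => holGrad (toComplexFun ρ) z - γ z) (p := p) (Γ := Γ)
    (by
      filter_upwards [hρd, hfd] with z h1 h2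
      exact h1.sub (h2.differentiableAt.const_mul 2))
    (by
      filter_upwards [hρd, hfd, hfγ] with z h1 h2 h3 h
      have e : HasFDerivAt (fun z => ρ z - 2 * (f z).re) _ z :=
        h1.hasFDerivAt.sub (h2.const_mul 2)
      rw [e.fderiv, sub_dotProduct, Complex.sub_re, mul_sub, ← h3,
        ← fderiv_eq_two_mul_re_holGrad h1]
      rfl)
    (by rw [hγp, sub_self])
    ((differentiableAt_holGrad hρ).hasFDerivAt.sub
      (hγ.differentiableAt.hasFDerivAt.restrictScalars ℝ))
  simp only [hρp, hfp, Complex.zero_re, mul_zero, sub_zero] at hψ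
  have hcont : Continuous fun h : CSpace n => (Γ h ⬝ᵥ h).re :=
    Complex.continuous_re.comp (Γ.continuous.dotProduct continuous_id)
  have := eventually_pos_on_zero_set (f := f)
    (hf.differentiableAt.hasFDerivAt.restrictScalars ℝ) hfp hcont
    (fun c h => by
      rw [map_smul, smul_dotProduct, dotProduct_smul, smul_smul, Complex.smul_re, smul_eq_mul, sq])
    hψ
    (fun h h0 hfh => by
      rw [hΓ]
      refine hpos h ?_ h0
      rw [← hγp, ← hfγ.self_of_nhds]
      exact hfh)
  filter_upwards [this] with z hz hfz
  have := hz hfz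
  rwa [hfz, Complex.zero_re, mul_zero, sub_zero] at this

theorem mainTheorem1 (n : ℕ) (Ω : Set (CSpace n)) (hΩ_open : IsOpen Ω) (hΩ_conn : IsConnected Ω)
    (p : CSpace n) (hp : p ∈ frontier Ω) (hΩ_spc : IsStrictlyPseudoconvexAt Ω p)
    (ρ : CSpace n → ℝ) (hρ : IsLocalDefiningFunction Ω p ρ)
    (V : Set (CSpace n)) (hV : IsOpen V) (hpV : p ∈ V) (P : HolomorphicPDO n V)
    (hchar : P.IsSimplyCharacteristicAt (toComplexFun ρ) p)
    (hpos : CondPos P ρ p) :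
    IsStronglyPConvexAt P Ω p := by
  obtain ⟨W, hW, hpW, hρW, hΩW, hfrW, hgrad⟩ := hρ
  obtain ⟨hch, j₀, hj₀⟩ := hchar
  have hρs : ContDiffAt ℝ (⊤ : ℕ∞) ρ p := hρW.contDiffAt (hW.mem_nhds hpW)
  have hρp : ρ p = 0 := by
    have : p ∈ frontier Ω ∩ W := ⟨hp, hpW⟩
    rw [hfrW] at this
    exact this.2
  set ζ₀ : CSpace n := holGrad (toComplexFun ρ) p with hζ₀
  have hζ₀ne : ζ₀ ≠ 0 := hgrad p ⟨hp, hpW⟩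
  set H : CSpace n × CSpace n → ℂ := fun w => P.symbol w.1 w.2 with hH
  have hHan : AnalyticAt ℂ H (p, ζ₀) := analyticAt_symbol P hpV ζ₀
  have hH0 : H (p, ζ₀) = 0 := hch
  set v : CSpace n := gradMom H (p, ζ₀) with hv
  have hvD : (fun j => P.symbolDzeta j p ζ₀) = v :=
    funext fun j => symbolDzeta_eq_gradMom P hpV ζ₀ j
  have hvj : v j₀ ≠ 0 := by rw [← hvD]; exact hj₀
  have hv0 : v ≠ 0 := fun h => hvj (by rw [h]; rfl)
  have hvT : ζ₀ ⬝ᵥ v = 0 := by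
    rw [hv, dotProduct_gradMom_symbol P hpV, hch, mul_zero]
  obtain ⟨hsymm, hherm⟩ := isSymm_and_isHermitian_hess hρs
  have hmixed : kkMixed P ρ p = gradPos H (p, ζ₀) + (hessMatrix ρ p).mulVec v := by
    ext j
    rw [kkMixed, symbolDz_eq_gradPos P hpV, Pi.add_apply, ← hvD]
    congr 1
    exact Finset.sum_congr rfl fun k _ => mul_comm _ _
  let T : Submodule ℂ (CSpace n) := LinearMap.ker (dotProductBilin ℂ ℂ ζ₀)
  have hT : ∀ t, t ∈ T ↔ ζ₀ ⬝ᵥ t = 0 := fun t => LinearMap.mem_ker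
  obtain ⟨M, hMsymm, hMv, hMpos⟩ := exists_symm_completion hherm T ((hT v).2 hvT) hv0
    (kkMixed P ρ p) (by
      intro a t ht hat
      have h1 := hpos (Fin.cons a t) (by
        rintro h
        have h0 : a = 0 := congrFun h 0
        have ht0 : t = 0 := funext fun i => congrFun h i.succ
        exact hat.elim (fun h => h h0) fun h => h ht0) (by
          rw [Fin.tail_cons]; exact (hT t).1 ht)
      rwa [kkForm_cons, hvD] at h1)
  -- The required Hessian of `f`; it is compatible with `P_m(z, ∂f) = 0` because `M v` is `q_{·,0}`.
  set F : Matrix (Fin (n + 1)) (Fin (n + 1)) ℂ := hessMatrix ρ p - M with hF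
  have hFv : ∀ h, F.mulVec h = (hessMatrix ρ p).mulVec h - M.mulVec h :=
    fun h => Matrix.sub_mulVec _ _ _
  have hFsymm : F.IsSymm := Matrix.IsSymm.sub hsymm hMsymm
  have hcomp : gradPos H (p, ζ₀) + F.mulVec v = 0 := by
    rw [hFv, hMv, hmixed]; abel
  have heul : ∀ᶠ w in 𝓝 (p, ζ₀), w.2 ⬝ᵥ gradMom H w = (P.order : ℂ) * H w := by
    have : ∀ᶠ w : CSpace n × CSpace n in 𝓝 (p, ζ₀), w.1 ∈ V :=
      (continuous_fst.tendsto (p, ζ₀)).eventually (hV.mem_nhds hpV)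
    filter_upwards [this] with w hw
    exact dotProduct_gradMom_symbol P hw w.2
  obtain ⟨f, γ, hf, hfp, hγ, hγp, hγd, hfγ⟩ := exists_hamiltonJacobi_solution
    (ℓ := Pi.single j₀ (v j₀)⁻¹) hHan heul hH0 (by simp [← hv, hvj]) hFsymm hcomp
  have hfpos := eventually_pos_of_jet hρs hρp hf hfp hγ hγp
    (fun h => (hγd h).trans (hFv h)) (hfγ.mono fun z hz => hz.1)
    (fun t ht ht0 => hMpos t ((hT t).2 ht) ht0)
  have hγne : ∀ᶠ z in 𝓝 p, γ z ≠ 0 := by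
    refine hγ.continuousAt.eventually_ne ?_
    rwa [hγp]
  obtain ⟨U, hU, hUo, hpU⟩ := eventually_nhds_iff.1 (hf.eventually_analyticAt.and
    (hfγ.and (hγne.and ((eventually_nhdsWithin_iff.1 hfpos).and
      ((hV.eventually_mem hpV).and (hW.eventually_mem hpW))))))
  have hgf : ∀ z ∈ U, holGrad f z = γ z := by
    intro z hz
    ext j
    rw [holGrad, wirtinger_eq_of_differentiableAt (hU z hz).1.differentiableAt,
      (hU z hz).2.1.1, dotProduct_single, mul_one]
  refine ⟨U, {z | z ∈ U ∧ f z = 0}, hUo, hpU, fun z hz => (hU z hz).2.2.2.2.1, ⟨f, ⟨?_, rfl, ?_⟩, ?_⟩,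
    ?_⟩
  · exact fun z hz => (hU z hz).1
  · rintro z ⟨hz, -⟩
    rw [hgf z hz]
    exact (hU z hz).2.2.1
  · rintro z ⟨hz, -⟩
    rw [HolomorphicPDO.IsCharacteristicAt, hgf z hz]
    exact (hU z hz).2.1.2
  · apply Set.Subset.antisymm
    · rintro z ⟨⟨⟨hz, hfz⟩, hcl⟩, -⟩
      by_contra hzp
      have h1 : 0 < ρ z := (hU z hz).2.2.2.1 hzp hfz
      have hzW : z ∈ W := (hU z hz).2.2.2.2.2
      rw [closure_eq_self_union_frontier] at hcl
      rcases hcl with h | h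
      · have h2 : z ∈ Ω ∩ W := ⟨h, hzW⟩
        rw [hΩW] at h2
        exact absurd h2.2 (not_lt.2 h1.le)
      · have h2 : z ∈ frontier Ω ∩ W := ⟨h, hzW⟩
        rw [hfrW] at h2
        exact absurd h2.2 h1.ne'
    · rintro z rfl
      exact ⟨⟨⟨hpU, hfp⟩, frontier_subset_closure hp⟩, hpU⟩

end
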